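/- **Theorem 1.2.** Let $\ell=\log\frac{3+\sqrt5}{2}$, $m=\frac{\sqrt5-1}{2}$, and let $H$ be $\mathbb C^3$ with the group law $$(u^1,u^2,u^3)*(w^1,w^2,w^3)=(u^1+w^1,\;e^{-w^1}u^2+w^2,\;e^{w^1}u^3+w^3).$$ Let $\Delta\subset H$ be the discrete cocompact subgroup generated by $(\ell,0,0)$, $(2\pi i,0,0)$, $(0,-m,1)$, $(0,1,m)$, $(0,-2\pi i m,2\pi i)$, $(0,2\pi i,2\pi i m)$, let $X=H/\Delta$ (quotient by right translations), and let $N=X\times S^1$ with $S^1=\mathbb R/2\pi\mathbb Z$. The right-invariant 1-forms $\Theta^1=dw^1$, $\Theta^2=e^{w^1}dw^2$, $\Theta^3=e^{-w^1}dw^3$ descend to $X$. Put $g^1=\mathrm{Re}\,\Theta^1$, $g^2=\mathrm{Im}\,\Theta^1$, let $g^3$ be the canonical 1-form of $S^1$, and put $$\omega=\tfrac i2\big(\Theta^2\wedge\overline{\Theta}{}^2+\Theta^3\wedge\overline{\Theta}{}^3\big),\qquad \Omega=\Theta^2\wedge\Theta^3 .$$ For $\alpha,\beta\in\mathbb R\setminus\{0\}$,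 $\lambda\in\mathbb C\setminus\{0\}$ and $\mu\ge 1$ let $$\phi(\alpha,\beta,\lambda;\mu)=\alpha\beta\, g^{1}\wedge g^2\wedge g^3+\alpha\mu^6\, g^1\wedge\omega-\beta\, g^2\wedge\mathrm{Re}(\lambda\Omega)+g^3\wedge\mathrm{Im}(\lambda\Omega).$$ Let $\mathfrak p:N\to\mathbb R/\ell\mathbb Z$ be the map induced by $((w^1,w^2,w^3),t)\mapsto \mathrm{Re}\,w^1$, and let $g_{\mathbb E}$ be the Euclidean metric on $\mathbb R/\ell\mathbb Z$. Recall that a 3-form $\varphi$ on a 7-dimensional real vector space is of $\mathrm G_2$-type if some basis $\theta^1,\dots,\theta^7$ of the dual space satisfies $\varphi=\theta^{123}+\theta^{145}+\theta^{167}+\theta^{246}-\theta^{257}-\theta^{347}-\theta^{356}$, and that it then induces the inner product $\sum_i\theta^i\otimes\theta^i$, which does not depend on the choice of the basis. Then, for all such $\alpha,\beta,\lambda$ and all $\mu\ge1$, the form $\mu^{-12}\phi(\alpha,\beta,\lambda;\mu)$ is of $\mathrm G_2$-type at every point of $N$ and induces a smooth Riemannian metric $g_\mu$ on $N$. With the Riemannian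 distances, $$\big(N,\,g_\mu\big)\longrightarrow\Big(\mathbb R/\ell\mathbb Z,\;\alpha^2(\lambda\overline\lambda)^{-2/3}g_{\mathbb E}\Big)\qquad(\mu\to\infty)$$ in the Gromov–Hausdorff sense. This is an adiabatic limit of the fibration $\mathfrak p$: writing $g_B=\alpha^2(\lambda\overline\lambda)^{-2/3}g_{\mathbb E}$, the map $\mathfrak p$ is a smooth surjective submersion, $g_\mu\to\mathfrak p^*g_B$ uniformly on $N$, and the Riemannian distances of $g_\mu$ converge to $d_{g_B}(\mathfrak p(x),\mathfrak p(y))$ uniformly in $x,y\in N$. -/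

import Mathlib

open Filter Topology Bundle
open scoped Manifold ContDiff

noncomputable section

namespace NakamuraG2

/-! ### Exterior algebra on a real vector space and the metric of a `G₂` 3-form -/

section LinearAlgebra

variable {V : Type*} [AddCommGroup V] [Module ℝ V] {A : Type*} [CommRing A] [Algebra ℝ A]

/-- The exterior product `a ∧ η` of a 1-form and an `n`-form with values in `A` (`= ℝ` or `ℂ`):
`(a ∧ η)(v₀, …, vₙ) = ∑ᵢ (-1)ⁱ a(vᵢ) η(v₀, …, v̂ᵢ, …, vₙ)`. -/
def wedge {n : ℕ} (a : V →ₗ[ℝ] A) (η : V [⋀^Fin n]→ₗ[ℝ] A) : V [⋀^Fin (n + 1)]→ₗ[ℝ] A :=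
  AlternatingMap.alternatizeUncurryFin
    { toFun := fun v => a v • η
      map_add' := fun u v => by rw [map_add, add_smul]
      map_smul' := fun c v => by rw [map_smul, RingHom.id_apply, Algebra.smul_def, mul_smul]; ext w; simp [Algebra.smul_def] }

/-- The exterior product `a ∧ b` of two 1-forms. -/
def wedge₂ (a b : V →ₗ[ℝ] A) : V [⋀^Fin 2]→ₗ[ℝ] A :=
  wedge a (AlternatingMap.ofSubsingleton ℝ V A (0 : Fin 1) b)

/-- The exterior product `a ∧ b ∧ c` of three 1-forms. -/
def wedge₃ (a b c : V →ₗ[ℝ] A) : V [⋀^Fin 3]→ₗ[ℝ] A :=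
  wedge a (wedge₂ b c)

/-- The 3-form `θ¹²³ + θ¹⁴⁵ + θ¹⁶⁷ + θ²⁴⁶ - θ²⁵⁷ - θ³⁴⁷ - θ³⁵⁶`
(with the indices `1, …, 7` shifted to `0, …, 6`). -/
def standardG2 (θ : Fin 7 → Module.Dual ℝ V) : V [⋀^Fin 3]→ₗ[ℝ] ℝ :=
  wedge₃ (θ 0) (θ 1) (θ 2) + wedge₃ (θ 0) (θ 3) (θ 4) + wedge₃ (θ 0) (θ 5) (θ 6)
    + wedge₃ (θ 1) (θ 3) (θ 5) - wedge₃ (θ 1) (θ 4) (θ 6) - wedge₃ (θ 2) (θ 3) (θ 6)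
    - wedge₃ (θ 2) (θ 4) (θ 5)

/-- `φ` is a `G₂` 3-form on the 7-dimensional space `V` (oriented by `φ`) and `g` is the inner
product it induces: there is a basis `θ¹, …, θ⁷` of the dual space in which `φ` is the standard
`G₂` 3-form, and `g = ∑ᵢ θⁱ ⊗ θⁱ`.  Since the stabiliser `G₂` of the standard form lies in `SO(7)`,
`g` does not depend on the basis. -/
def IsG2Metric (φ : V [⋀^Fin 3]→ₗ[ℝ] ℝ) (g : V → V → ℝ) : Prop :=
  ∃ θ : Module.Basis (Fin 7) ℝ (Module.Dual ℝ V),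
    φ = standardG2 θ ∧ ∀ u v, g u v = ∑ i, θ i u * θ i v

end LinearAlgebra

/-! ### Riemannian distance and Gromov–Hausdorff convergence -/

/-- The metric space structure `d` is the one induced on the manifold `M` by the Riemannian
metric `g`: it induces the topology of `M`, and the distance between two points is the infimum of
the `g`-lengths of the `C¹` paths joining them. -/
structure IsRiemannianDistance {E : Type*} [NormedAddCommGroup E] [NormedSpace ℝ E]
    {H : Type*} [TopologicalSpace H] {I : ModelWithCorners ℝ E H}
    {M : Type*} [t : TopologicalSpace M] [ChartedSpace H M] [IsManifold I 1 M]
    (g : ContMDiffRiemannianMetric I ∞ E (fun x : M => TangentSpace I x))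
    (d : MetricSpace M) : Prop where
  topology_eq : d.toUniformSpace.toTopologicalSpace = t
  edist_eq : letI : RiemannianBundle (fun x : M => TangentSpace I x) := ⟨g.toRiemannianMetric⟩
    ∀ x y : M, d.edist x y = Manifold.riemannianEDist I x y

/-- The metric spaces `(X, d i)` and `(Y, d')` are compact, and `(X, d i)` converges to `(Y, d')`
along the filter `l` for the Gromov–Hausdorff distance. -/
def GHConverges {ι : Type*} (l : Filter ι) {X Y : Type*} [Nonempty X] [Nonempty Y]
    (d : ι → MetricSpace X) (d' : MetricSpace Y) : Prop :=
  ∃ (hX : ∀ i, @CompactSpace X (d i).toUniformSpace.toTopologicalSpace)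
    (hY : @CompactSpace Y d'.toUniformSpace.toTopologicalSpace),
    Tendsto (fun i => @GromovHausdorff.toGHSpace X (d i) (hX i) _) l
      (𝓝 (@GromovHausdorff.toGHSpace Y d' hY _))

/-! ### Quotients of a vector space by a smooth action, through a local homeomorphism -/

section Quotient

variable {E : Type*} [NormedAddCommGroup E] [NormedSpace ℝ E] {X : Type*} [TopologicalSpace X]
  {f : E → X} {s : X → E}

/-- If the points of the fibres of `f` are related by smooth maps compatible with `f`, then the
local inverses of `f` form a smooth atlas. -/
theorem isManifold_of_isLocalHomeomorph (hf : IsLocalHomeomorph f)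
    (hs : Function.RightInverse s f)
    (hT : ∀ a b, f a = f b → ∃ T : E → E, ContDiff ℝ ∞ T ∧ (∀ z, f (T z) = f z) ∧ T a = b) :
    @IsManifold ℝ _ E _ _ E _ 𝓘(ℝ, E) ∞ X _ (hf.chartedSpaceOfRightInverse hs) := by
  let _ := hf.chartedSpaceOfRightInverse (H := E) hs
  apply isManifold_of_contDiffOn
  rintro e e' ⟨q, rfl⟩ ⟨q', rfl⟩
  simp only [chartAt_self_eq, OpenPartialHomeomorph.trans_refl, modelWithCornersSelf_coe,
    modelWithCornersSelf_coe_symm, Function.id_comp, Function.comp_id, Set.preimage_id,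
    Set.range_id, Set.inter_univ]
  set e := hf.localInverseAt (s q)
  set e' := hf.localInverseAt (s q')
  intro x hx
  have hx' : f x ∈ e'.source := by simpa [e] using hx.2
  have hfy : f (e' (f x)) = f x := hf.apply_localInverseAt_of_mem hx'
  obtain ⟨T, hTs, hTf, hTx⟩ := hT x (e' (f x)) hfy.symm
  have hmem : T ⁻¹' e'.target ∈ 𝓝 x :=
    (e'.open_target.preimage hTs.continuous).mem_nhds (by
      simpa [hTx] using e'.map_source hx')
  refine (hTs.contDiffAt.congr_of_eventuallyEq ?_).contDiffWithinAt
  filter_upwards [hmem] with z hz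
  have h1 : e'.symm (T z) = f z := by rw [hf.localInverseAt_symm, hTf]
  have h2 : e.symm z = f z := by rw [hf.localInverseAt_symm]
  simp only [OpenPartialHomeomorph.coe_trans, Function.comp_apply, h2]
  rw [← h1, e'.right_inv hz]

/-- The `F`-valued 1-form at `x ∈ X` obtained by pulling back a 1-form `η` on `E` along the local
inverse of `f` that sends `x` to `s x`.  If `η` is invariant under the maps relating the points of
the fibres of `f`, this is the 1-form on `X` to which `η` descends, whatever `s`. -/
def descend {F : Type*} [NormedAddCommGroup F] [NormedSpace ℝ F] [ChartedSpace E X]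
    (hf : IsLocalHomeomorph f) (s : X → E) (η : E → E →L[ℝ] F) (x : X) :
    TangentSpace 𝓘(ℝ, E) x →L[ℝ] F :=
  (η (hf.localInverseAt (s x) x)).comp
    (mfderiv 𝓘(ℝ, E) 𝓘(ℝ, E) (hf.localInverseAt (s x)) x)

end Quotient

/-! ### The group `H`, the lattice `Δ` and the Nakamura manifold -/

/-- The complex Lie group `H`: points of `ℂ³`, with the product
`(u¹, u², u³) * (w¹, w², w³) = (u¹ + w¹, e^{-w¹} u² + w², e^{w¹} u³ + w³)`. -/
@[ext]
structure H where
  w1 : ℂ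
  w2 : ℂ
  w3 : ℂ

namespace H

/-- The coordinates `H ≃ ℂ³`. -/
def coords : H ≃ ℂ × ℂ × ℂ where
  toFun w := (w.w1, w.w2, w.w3)
  invFun v := ⟨v.1, v.2.1, v.2.2⟩
  left_inv _ := rfl
  right_inv _ := rfl

instance : TopologicalSpace H := TopologicalSpace.induced coords inferInstance

/-- The coordinates as a homeomorphism `H ≃ₜ ℂ³`. -/
def coordsHomeo : H ≃ₜ ℂ × ℂ × ℂ := coords.toHomeomorphOfIsInducing ⟨rfl⟩

instance : Mul H :=
  ⟨fun u w => ⟨u.w1 + w.w1, Complex.exp (-w.w1) * u.w2 + w.w2, Complex.exp w.w1 * u.w3 + w.w3⟩⟩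

instance : One H := ⟨⟨0, 0, 0⟩⟩

instance : Inv H :=
  ⟨fun u => ⟨-u.w1, -(Complex.exp u.w1 * u.w2), -(Complex.exp (-u.w1) * u.w3)⟩⟩

theorem mul_def (u w : H) : u * w =
    ⟨u.w1 + w.w1, Complex.exp (-w.w1) * u.w2 + w.w2, Complex.exp w.w1 * u.w3 + w.w3⟩ := rfl

theorem one_def : (1 : H) = ⟨0, 0, 0⟩ := rfl

theorem inv_def (u : H) : u⁻¹ =
    ⟨-u.w1, -(Complex.exp u.w1 * u.w2), -(Complex.exp (-u.w1) * u.w3)⟩ := rfl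

instance : Group H :=
  Group.ofLeftAxioms
    (fun u v w => by
      simp only [mul_def, mk.injEq, neg_add, Complex.exp_add]
      refine ⟨?_, ?_, ?_⟩ <;> ring)
    (fun u => by simp [mul_def, one_def])
    (fun u => by
      simp only [mul_def, one_def, inv_def, mk.injEq, mul_neg, ← mul_assoc, ← Complex.exp_add]
      simp)

instance : IsTopologicalGroup H where
  continuous_mul := by
    have h : Continuous fun p : (ℂ × ℂ × ℂ) × (ℂ × ℂ × ℂ) =>
        ((p.1.1 + p.2.1, Complex.exp (-p.2.1) * p.1.2.1 + p.2.2.1,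
          Complex.exp p.2.1 * p.1.2.2 + p.2.2.2) : ℂ × ℂ × ℂ) := by fun_prop
    exact coordsHomeo.symm.continuous.comp
      (h.comp (coordsHomeo.continuous.prodMap coordsHomeo.continuous))
  continuous_inv := by
    have h : Continuous fun u : ℂ × ℂ × ℂ =>
        ((-u.1, -(Complex.exp u.1 * u.2.1), -(Complex.exp (-u.1) * u.2.2)) : ℂ × ℂ × ℂ) := by
      fun_prop
    exact coordsHomeo.symm.continuous.comp (h.comp coordsHomeo.continuous)

end H

/-- `ℓ = log ((3 + √5) / 2)`. -/
def ell : ℝ := Real.log ((3 + √5) / 2)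

/-- `m = (√5 - 1) / 2`. -/
def m : ℝ := (√5 - 1) / 2

/-- The six elements `e₁, …, e₆` of `H`. -/
def latticeGen : Fin 6 → H :=
  ![⟨ell, 0, 0⟩, ⟨2 * Real.pi * Complex.I, 0, 0⟩, ⟨0, -m, 1⟩, ⟨0, 1, m⟩,
    ⟨0, -(2 * Real.pi * Complex.I * m), 2 * Real.pi * Complex.I⟩,
    ⟨0, 2 * Real.pi * Complex.I, 2 * Real.pi * Complex.I * m⟩]

/-- The uniform subgroup `Δ` of `H` generated by `e₁, …, e₆`. -/
def Delta : Subgroup H := Subgroup.closure (Set.range latticeGen)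

/-- The additive group `P(ℤ² + 2πi ℤ²)`, with `P` the matrix with rows `(-m, 1)` and `(1, m)`. -/
def fibreLattice : AddSubgroup (ℂ × ℂ) where
  carrier := {v | ∃ a b c d : ℤ,
    v.1 = -m * (a + 2 * Real.pi * Complex.I * c) + (b + 2 * Real.pi * Complex.I * d) ∧
    v.2 = (a + 2 * Real.pi * Complex.I * c) + m * (b + 2 * Real.pi * Complex.I * d)}
  zero_mem' := ⟨0, 0, 0, 0, by simp⟩
  add_mem' := by
    rintro v w ⟨a, b, c, d, h1, h2⟩ ⟨a', b', c', d', h1', h2'⟩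
    refine ⟨a + a', b + b', c + c', d + d', ?_, ?_⟩
    · simp only [Prod.fst_add, h1, h1']; push_cast; ring
    · simp only [Prod.snd_add, h2, h2']; push_cast; ring
  neg_mem' := by
    rintro v ⟨a, b, c, d, h1, h2⟩
    refine ⟨-a, -b, -c, -d, ?_, ?_⟩
    · simp only [Prod.fst_neg, h1]; push_cast; ring
    · simp only [Prod.snd_neg, h2]; push_cast; ring

theorem sqrt5_sq : (√5 : ℝ) * √5 = 5 := Real.mul_self_sqrt (by norm_num)

theorem exp_ell : Real.exp ell = 2 + m := by
  have : (0 : ℝ) < (3 + √5) / 2 := by positivity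
  rw [ell, Real.exp_log this, m]; ring

theorem m_sq : m * m = 1 - m := by
  have := sqrt5_sq
  rw [m]; linarith

theorem exp_neg_ell : Real.exp (-ell) = 1 - m := by
  rw [Real.exp_neg, exp_ell]
  apply inv_eq_of_mul_eq_one_right
  linear_combination -m_sq

theorem cexp_ell : Complex.exp ell = 2 + m := by
  rw [← Complex.ofReal_exp, exp_ell]; push_cast; rfl

theorem cexp_neg_ell : Complex.exp (-ell) = 1 - m := by
  rw [← Complex.ofReal_neg, ← Complex.ofReal_exp, exp_neg_ell]; push_cast; rfl

theorem cm_sq : (m : ℂ) * m = 1 - m := by exact_mod_cast congrArg (fun x : ℝ => (x : ℂ)) m_sq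

theorem fibreLattice_up {v : ℂ × ℂ} (hv : v ∈ fibreLattice) :
    (Complex.exp (-ell) * v.1, Complex.exp ell * v.2) ∈ fibreLattice := by
  obtain ⟨a, b, c, d, h1, h2⟩ := hv
  have := cm_sq
  refine ⟨2 * a + b, a + b, 2 * c + d, c + d, ?_, ?_⟩
  · simp only [h1, cexp_neg_ell]; push_cast
    linear_combination (a + 2 * Real.pi * Complex.I * c) * this
  · simp only [h2, cexp_ell]; push_cast
    linear_combination (b + 2 * Real.pi * Complex.I * d) * this

theorem fibreLattice_down {v : ℂ × ℂ} (hv : v ∈ fibreLattice) :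
    (Complex.exp ell * v.1, Complex.exp (-ell) * v.2) ∈ fibreLattice := by
  obtain ⟨a, b, c, d, h1, h2⟩ := hv
  have := cm_sq
  refine ⟨a - b, -a + 2 * b, c - d, -c + 2 * d, ?_, ?_⟩
  · simp only [h1, cexp_ell]; push_cast
    linear_combination -(a + 2 * Real.pi * Complex.I * c) * this
  · simp only [h2, cexp_neg_ell]; push_cast
    linear_combination -(b + 2 * Real.pi * Complex.I * d) * this

theorem fibreLattice_zpow (k : ℤ) : ∀ {v : ℂ × ℂ}, v ∈ fibreLattice →
    (Complex.exp (-(k * ell)) * v.1, Complex.exp (k * ell) * v.2) ∈ fibreLattice := by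
  induction k with
  | zero => intro v hv; simpa using hv
  | succ k ih =>
    intro v hv
    convert! fibreLattice_up (ih hv) using 2
    · rw [← mul_assoc, ← Complex.exp_add]; push_cast; ring_nf
    · rw [← mul_assoc, ← Complex.exp_add]; push_cast; ring_nf
  | pred k ih =>
    intro v hv
    convert! fibreLattice_down (ih hv) using 2
    · rw [← mul_assoc, ← Complex.exp_add]; push_cast; ring_nf
    · rw [← mul_assoc, ← Complex.exp_add]; push_cast; ring_nf

theorem exp_lattice (k j : ℤ) :
    Complex.exp (k * ell + 2 * Real.pi * Complex.I * j) = Complex.exp (k * ell) := by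
  rw [Complex.exp_add, mul_comm _ (j : ℂ), Complex.exp_int_mul_two_pi_mul_I, mul_one]

theorem exp_neg_lattice (k j : ℤ) :
    Complex.exp (-(k * ell + 2 * Real.pi * Complex.I * j)) = Complex.exp (-(k * ell)) := by
  rw [Complex.exp_neg, exp_lattice, Complex.exp_neg]

/-- An explicit description of `Δ`, used to see that it is discrete. -/
def latticeSubgroup : Subgroup H where
  carrier := {w | (∃ k j : ℤ, w.w1 = k * ell + 2 * Real.pi * Complex.I * j) ∧
    (w.w2, w.w3) ∈ fibreLattice}
  one_mem' := ⟨⟨0, 0, by simp [H.one_def]⟩, fibreLattice.zero_mem⟩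
  mul_mem' := by
    rintro u w ⟨⟨k, j, h⟩, hu⟩ ⟨⟨k', j', h'⟩, hw⟩
    refine ⟨⟨k + k', j + j', ?_⟩, ?_⟩
    · simp only [H.mul_def, h, h']; push_cast; ring
    · have := fibreLattice.add_mem (fibreLattice_zpow k' hu) hw
      simpa only [H.mul_def, h', exp_lattice, exp_neg_lattice, Prod.mk_add_mk] using this
  inv_mem' := by
    rintro u ⟨⟨k, j, h⟩, hu⟩
    refine ⟨⟨-k, -j, ?_⟩, ?_⟩
    · simp only [H.inv_def, h]; push_cast; ring
    · have := fibreLattice.neg_mem (fibreLattice_zpow (-k) hu)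
      simp only [H.inv_def, h, exp_lattice, exp_neg_lattice]
      simpa using this

theorem Delta_le : Delta ≤ latticeSubgroup := by
  rw [Delta, Subgroup.closure_le]
  rintro _ ⟨i, rfl⟩
  fin_cases i
  · exact ⟨⟨1, 0, by simp [latticeGen]⟩, fibreLattice.zero_mem⟩
  · exact ⟨⟨0, 1, by simp [latticeGen]⟩, fibreLattice.zero_mem⟩
  · exact ⟨⟨0, 0, by simp [latticeGen]⟩, 1, 0, 0, 0, by simp [latticeGen]⟩
  · exact ⟨⟨0, 0, by simp [latticeGen]⟩, 0, 1, 0, 0, by simp [latticeGen]⟩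
  · exact ⟨⟨0, 0, by simp [latticeGen]⟩, 0, 0, 1, 0, by simp [latticeGen]; ring⟩
  · exact ⟨⟨0, 0, by simp [latticeGen]⟩, 0, 0, 0, 1, by simp [latticeGen]; ring⟩

theorem int_eq_zero {a c : ℤ} (h : ‖(a + 2 * Real.pi * Complex.I * c : ℂ)‖ < 1) :
    a = 0 ∧ c = 0 := by
  have h1 := (Complex.abs_re_le_norm _).trans_lt h
  have h2 := (Complex.abs_im_le_norm _).trans_lt h
  simp only [Complex.add_re, Complex.intCast_re, Complex.mul_re, Complex.add_im,
    Complex.intCast_im, Complex.mul_im, Complex.re_ofNat, Complex.im_ofNat, Complex.ofReal_re,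
    Complex.ofReal_im, Complex.I_re, Complex.I_im] at h1 h2
  ring_nf at h1 h2
  refine ⟨Int.abs_lt_one_iff.mp (by exact_mod_cast h1), Int.abs_lt_one_iff.mp ?_⟩
  rw [abs_mul, abs_mul, abs_of_pos Real.pi_pos, abs_two] at h2
  have : |(c : ℝ)| < 1 := by nlinarith [Real.pi_gt_three, abs_nonneg (c : ℝ)]
  exact_mod_cast this

theorem half_lt_ell : 1 / 2 < ell := by
  have h : Real.log 2 ≤ ell := by
    apply Real.log_le_log two_pos
    have : 1 ≤ √5 := Real.one_le_sqrt.mpr (by norm_num)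
    linarith
  linarith [Real.log_two_gt_d9]

theorem m_pos : 0 < m := by
  have : 1 < √5 := Real.lt_sqrt_of_sq_lt (by norm_num)
  rw [m]; linarith

theorem m_lt_one : m < 1 := by nlinarith [m_pos, m_sq]

theorem eq_one_of_mem_Delta {w : H} (hw : w ∈ Delta) (h1 : ‖w.w1‖ < 1 / 2) (h2 : ‖w.w2‖ < 1 / 2)
    (h3 : ‖w.w3‖ < 1 / 2) : w = 1 := by
  obtain ⟨⟨k, j, hkj⟩, a, b, c, d, hab, hcd⟩ := Delta_le hw
  dsimp only at hab hcd
  have key : ∀ {z x y : ℂ}, (1 + (m : ℂ) * m) * z = x + m * y → ‖x‖ < 1 / 2 → ‖y‖ < 1 / 2 →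
      ‖z‖ < 1 := by
    intro z x y h hx hy
    have e1 : ‖(1 + (m : ℂ) * m)‖ = 1 + m * m := by
      rw [← Complex.ofReal_mul, ← Complex.ofReal_one, ← Complex.ofReal_add, Complex.norm_real,
        Real.norm_of_nonneg (by nlinarith [m_pos])]
    have e2 : (1 + m * m) * ‖z‖ ≤ ‖x‖ + m * ‖y‖ := by
      rw [← e1, ← norm_mul, h]
      refine (norm_add_le _ _).trans ?_
      rw [norm_mul, Complex.norm_real, Real.norm_of_nonneg m_pos.le]
    nlinarith [m_pos, m_lt_one, norm_nonneg z, norm_nonneg y, mul_nonneg (mul_self_nonneg m)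
      (norm_nonneg z)]
  have hA := int_eq_zero (a := a) (c := c) (key (x := w.w3) (y := -w.w2)
    (by rw [hab, hcd]; ring) h3 (by rwa [norm_neg]))
  have hB := int_eq_zero (a := b) (c := d) (key (x := w.w2) (y := w.w3)
    (by rw [hab, hcd]; ring) h2 h3)
  have hre := (Complex.abs_re_le_norm _).trans_lt h1
  rw [hkj] at hre
  simp only [Complex.add_re, Complex.mul_re, Complex.intCast_re, Complex.ofReal_re,
    Complex.intCast_im, Complex.ofReal_im, Complex.I_re, Complex.I_im, Complex.mul_im,
    Complex.re_ofNat, Complex.im_ofNat] at hre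
  ring_nf at hre
  have hk : k = 0 := by
    rw [abs_mul, abs_of_pos (by linarith [half_lt_ell] : 0 < ell)] at hre
    have : |(k : ℝ)| < 1 := by nlinarith [half_lt_ell, abs_nonneg (k : ℝ)]
    exact Int.abs_lt_one_iff.mp (by exact_mod_cast this)
  have hj := int_eq_zero (a := 0) (c := j) (by
    rw [hkj, hk] at h1
    have h0 : ‖((0 : ℤ) : ℂ) + 2 * Real.pi * Complex.I * j‖ < 1 / 2 := by
      rwa [Int.cast_zero, zero_mul] at *
    exact h0.trans (by norm_num))
  ext
  · simp [hkj, hk, hj.2, H.one_def]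
  · simp [hab, hA.1, hA.2, hB.1, hB.2, H.one_def]
  · simp [hcd, hA.1, hA.2, hB.1, hB.2, H.one_def]

theorem continuous_coords : Continuous fun w : H => (w.w1, w.w2, w.w3) := H.coordsHomeo.continuous

theorem isDiscrete_Delta : IsDiscrete (Delta : Set H) := by
  refine ⟨discreteTopology_of_isOpen_singleton_one (G := Delta) ?_⟩
  have ho : IsOpen {v : ℂ × ℂ × ℂ | ‖v.1‖ < 1 / 2 ∧ ‖v.2.1‖ < 1 / 2 ∧ ‖v.2.2‖ < 1 / 2} :=
    IsOpen.and (isOpen_lt (by fun_prop) (by fun_prop))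
      (IsOpen.and (isOpen_lt (by fun_prop) (by fun_prop)) (isOpen_lt (by fun_prop) (by fun_prop)))
  convert! (ho.preimage continuous_coords).preimage (continuous_subtype_val (p := (· ∈ Delta)))
  ext ⟨w, hw⟩
  simp only [Set.mem_singleton_iff, Set.mem_preimage, Set.mem_ofPred_eq]
  constructor
  · rintro h
    obtain rfl : w = 1 := congrArg Subtype.val h
    simp [H.one_def]
  · rintro ⟨h1, h2, h3⟩
    exact Subtype.ext (eq_one_of_mem_Delta hw h1 h2 h3)

/-- The Nakamura manifold `X = H / Δ`, the quotient of `H` by the right translations by the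
elements of `Δ` (`h` is identified with `h * δ`). -/
abbrev X : Type := H ⧸ Delta

/-- The quotient map `ℂ³ ≅ H → X`. -/
def toX (w : ℂ × ℂ × ℂ) : X := QuotientGroup.mk (H.coordsHomeo.symm w)

theorem isLocalHomeomorph_toX : IsLocalHomeomorph toX :=
  (Delta.isQuotientCoveringMap isDiscrete_Delta).isCoveringMap.isLocalHomeomorph.comp
    H.coordsHomeo.symm.isLocalHomeomorph

/-- A choice of a point of `ℂ³` above each point of `X`. -/
def liftX (x : X) : ℂ × ℂ × ℂ := H.coordsHomeo (Quotient.out x)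

theorem rightInverse_liftX : Function.RightInverse liftX toX := fun x => by
  simp [toX, liftX]

/-- The charts of `X` are the local inverses of `ℂ³ ≅ H → X`. -/
instance : ChartedSpace (ℂ × ℂ × ℂ) X :=
  isLocalHomeomorph_toX.chartedSpaceOfRightInverse rightInverse_liftX

instance : IsManifold 𝓘(ℝ, ℂ × ℂ × ℂ) ∞ X := by
  refine isManifold_of_isLocalHomeomorph isLocalHomeomorph_toX rightInverse_liftX fun a b hab => ?_
  have h := QuotientGroup.eq.mp hab
  set δ : H := (H.coordsHomeo.symm a)⁻¹ * H.coordsHomeo.symm b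
  refine ⟨fun z => (z.1 + δ.w1, Complex.exp (-δ.w1) * z.2.1 + δ.w2,
    Complex.exp δ.w1 * z.2.2 + δ.w3), by fun_prop, fun z => ?_, ?_⟩
  · exact (QuotientGroup.mk_mul_of_mem (H.coordsHomeo.symm z) h :)
  · exact congrArg H.coordsHomeo (mul_inv_cancel_left (H.coordsHomeo.symm a) _)

/-! ### Circles -/

section Circle

variable (T : ℝ)

/-- A choice of a real number above each point of `ℝ / Tℤ`. -/
def liftCircle (t : AddCircle T) : ℝ := Quotient.out t

theorem rightInverse_liftCircle :
    Function.RightInverse (liftCircle T) ((↑) : ℝ → AddCircle T) :=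
  fun t => Quotient.out_eq t

/-- The charts of `ℝ / Tℤ` are the local inverses of `ℝ → ℝ / Tℤ`. -/
instance : ChartedSpace ℝ (AddCircle T) :=
  (AddCircle.isLocalHomeomorph_coe T).chartedSpaceOfRightInverse (rightInverse_liftCircle T)

instance : IsManifold 𝓘(ℝ, ℝ) ∞ (AddCircle T) := by
  refine isManifold_of_isLocalHomeomorph (AddCircle.isLocalHomeomorph_coe T)
    (rightInverse_liftCircle T) fun a b hab => ⟨fun z => z + (b - a), by fun_prop, fun z => ?_, ?_⟩
  · rw [AddCircle.coe_add, AddCircle.coe_sub, hab]; simp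
  · ring

/-- The canonical 1-form `dt` on `ℝ / Tℤ`. -/
def dt (t : AddCircle T) : TangentSpace 𝓘(ℝ, ℝ) t →L[ℝ] ℝ :=
  descend (AddCircle.isLocalHomeomorph_coe T) (liftCircle T)
    (fun _ => ContinuousLinearMap.id ℝ ℝ) t

end Circle

/-! ### The 7-manifold `N`, its forms and the fibration over `ℝ / ℓℤ` -/

/-- The 7-manifold `N = X × S¹`, with `S¹ = ℝ / 2πℤ`. -/
abbrev N : Type := X × AddCircle (2 * Real.pi)

/-- The real model of `N`. -/
abbrev IN : ModelWithCorners ℝ ((ℂ × ℂ × ℂ) × ℝ) (ModelProd (ℂ × ℂ × ℂ) ℝ) :=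
  𝓘(ℝ, ℂ × ℂ × ℂ).prod 𝓘(ℝ, ℝ)

/-- The (real-linear) coordinate forms `dw¹, dw², dw³` on `ℂ³`. -/
def dw : Fin 3 → (ℂ × ℂ × ℂ) →L[ℝ] ℂ :=
  ![ContinuousLinearMap.fst ℝ ℂ (ℂ × ℂ),
    (ContinuousLinearMap.fst ℝ ℂ ℂ).comp (ContinuousLinearMap.snd ℝ ℂ (ℂ × ℂ)),
    (ContinuousLinearMap.snd ℝ ℂ ℂ).comp (ContinuousLinearMap.snd ℝ ℂ (ℂ × ℂ))]

/-- The right-invariant 1-forms `Θ¹ = dw¹`, `Θ² = e^{w¹} dw²`, `Θ³ = e^{-w¹} dw³` on `H ≅ ℂ³`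
(numbered from `0`). -/
def ThetaH (i : Fin 3) (w : ℂ × ℂ × ℂ) : (ℂ × ℂ × ℂ) →L[ℝ] ℂ :=
  (![1, Complex.exp w.1, Complex.exp (-w.1)] i) • dw i

/-- The 1-forms on `X` to which `Θ¹, Θ², Θ³` descend. -/
def ThetaX (i : Fin 3) (x : X) : TangentSpace 𝓘(ℝ, ℂ × ℂ × ℂ) x →L[ℝ] ℂ :=
  descend isLocalHomeomorph_toX liftX (ThetaH i) x

/-- The 1-forms `Θ¹, Θ², Θ³` on `N` (pulled back from `X`). -/
def Theta (i : Fin 3) (x : N) : TangentSpace IN x →ₗ[ℝ] ℂ :=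
  ((ThetaX i x.1).comp (mfderiv IN 𝓘(ℝ, ℂ × ℂ × ℂ) Prod.fst x)).toLinearMap

/-- The complex conjugates of `Θ¹, Θ², Θ³`. -/
def ThetaBar (i : Fin 3) (x : N) : TangentSpace IN x →ₗ[ℝ] ℂ :=
  Complex.conjLIE.toLinearEquiv.toLinearMap ∘ₗ Theta i x

/-- `g¹ = Re Θ¹`. -/
def g1 (x : N) : TangentSpace IN x →ₗ[ℝ] ℝ := Complex.reLm ∘ₗ Theta 0 x

/-- `g² = Im Θ¹`. -/
def g2 (x : N) : TangentSpace IN x →ₗ[ℝ] ℝ := Complex.imLm ∘ₗ Theta 0 x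

/-- `g³`, the canonical 1-form of the factor `S¹` of `N`. -/
def g3 (x : N) : TangentSpace IN x →ₗ[ℝ] ℝ :=
  ((dt _ x.2).comp (mfderiv IN 𝓘(ℝ, ℝ) Prod.snd x)).toLinearMap

/-- The real 2-form `ω = (i/2) (Θ² ∧ Θ̄² + Θ³ ∧ Θ̄³)` (the right-hand side takes real values). -/
def omega (x : N) : TangentSpace IN x [⋀^Fin 2]→ₗ[ℝ] ℝ :=
  Complex.reLm.compAlternatingMap
    ((Complex.I / 2) • (wedge₂ (Theta 1 x) (ThetaBar 1 x) + wedge₂ (Theta 2 x) (ThetaBar 2 x)))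

/-- The complex 2-form `Ω = Θ² ∧ Θ³`. -/
def Omega (x : N) : TangentSpace IN x [⋀^Fin 2]→ₗ[ℝ] ℂ := wedge₂ (Theta 1 x) (Theta 2 x)

/-- The 3-form `φ(α, β, λ; μ) = αβ g¹²³ + α μ⁶ g¹ ∧ ω - β g² ∧ Re(λΩ) + g³ ∧ Im(λΩ)` on `N`. -/
def phi (α β : ℝ) (lam : ℂ) (μ : ℝ) (x : N) : TangentSpace IN x [⋀^Fin 3]→ₗ[ℝ] ℝ :=
  (α * β) • wedge₃ (g1 x) (g2 x) (g3 x) + (α * μ ^ 6) • wedge (g1 x) (omega x)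
    - β • wedge (g2 x) (Complex.reLm.compAlternatingMap (lam • Omega x))
    + wedge (g3 x) (Complex.imLm.compAlternatingMap (lam • Omega x))

/-- The homomorphism `H → ℝ / ℓℤ`, `w ↦ Re w¹`. -/
def reMod : H →* Multiplicative (AddCircle ell) where
  toFun w := Multiplicative.ofAdd (w.w1.re : AddCircle ell)
  map_one' := by simp [H.one_def]
  map_mul' u w := by simp [H.mul_def]

theorem reMod_apply (w : H) : reMod w = Multiplicative.ofAdd (w.w1.re : AddCircle ell) := rfl

theorem Delta_le_ker : Delta ≤ reMod.ker := by
  rw [Delta, Subgroup.closure_le]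
  rintro _ ⟨i, rfl⟩
  fin_cases i <;> simp [reMod_apply, latticeGen, MonoidHom.mem_ker]

/-- The fibration `p : N → ℝ / ℓℤ`, `([w¹, w², w³], t) ↦ Re w¹`. -/
def proj (x : N) : AddCircle ell :=
  Quotient.liftOn' x.1 (fun w : H => (w.w1.re : AddCircle ell)) fun a b hab => by
    have h := Delta_le_ker (QuotientGroup.leftRel_apply.mp hab)
    rw [MonoidHom.mem_ker, map_mul, map_inv, inv_mul_eq_one] at h
    exact h

end NakamuraG2

end

/-! Everything is computed on the covering `toN` from ℂ³ × ℝ to `N`. The deck transformations are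
right translations by `Delta` and shifts of the circle coordinate; they preserve Θ¹, Θ², Θ³ and dt.
A sum of squares of constant combinations of these forms therefore descends to a smooth metric on
`N`.

Put r = |λ|^(1/3). After division by μ¹², the form φ is the standard G₂ form in the coframe `frame`,
that is, up to signs and the phase of λ, (α/r²) Re Θ¹, (βr/μ⁶) Im Θ¹, (r/μ⁶) dt, and (r/μ³) times
the real and imaginary parts of Θ² and Θ³ (`standardG2_coframe`, `isG2Metric_metricN`). Only the
first covector has a coefficient independent of μ, and its square is the pull-back of the base
metric. Hence the metric on `N` is this pull-back plus a nonnegative vertical part of size O(μ⁻⁶)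
relative to the metric at μ = 1 (`metricN_sub_metricB_le`).

For the distances, `proj` is 1-Lipschitz because the vertical part is nonnegative. The curve s ↦
([s, 0, 0], 0) is tangent to the common kernel of the other six covectors and closes up after `ell`,
because (ℓ, 0, 0) lies in `Delta`. It gives a section `sec` that does not increase lengths, so `sec`
embeds the base isometrically for every μ (`dist_sec`). Cocompactness of `Delta` lets each point be
joined to the section by a vertical segment of bounded coordinate size, hence of length at most
`fibreConst` / μ³ (`riemEDist_sec_proj_le`). So the base sits in `N` isometrically with image
`fibreConst` / μ³-dense. This yields both the Gromov–Hausdorff limit and the uniform convergence of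
distances, with no formula for the distance on the circle. -/

noncomputable section

namespace NakamuraG2

/-! ### Smooth metrics on a quotient from forms on its covering. -/

section Sections

variable {E : Type*} [NormedAddCommGroup E] [NormedSpace ℝ E]
  {H : Type*} [TopologicalSpace H] {I : ModelWithCorners ℝ E H}
  {M : Type*} [TopologicalSpace M] [ChartedSpace H M]
  {E' : Type*} [NormedAddCommGroup E'] [NormedSpace ℝ E']

variable (I) in
/-- `F` is a smooth surjection with smooth local sections through every point. -/
structure HasSmoothSections (F : E' → M) : Prop where
  contMDiff : ContMDiff 𝓘(ℝ, E') I ∞ F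
  surjective : Function.Surjective F
  exists_section (a : E') : ∃ c : M → E', ContMDiffAt I 𝓘(ℝ, E') ∞ c (F a) ∧ c (F a) = a ∧
    ∀ᶠ x in 𝓝 (F a), F (c x) = x

namespace HasSmoothSections

variable {F : E' → M} (hF : HasSmoothSections I F)
include hF

theorem mdifferentiableAt (a : E') : MDifferentiableAt 𝓘(ℝ, E') I F a :=
  hF.contMDiff.mdifferentiable (by simp) a

/-- A map is smooth if its composition with `F` is. -/
theorem contMDiff_of_comp {EP : Type*} [NormedAddCommGroup EP] [NormedSpace ℝ EP]
    {HP : Type*} [TopologicalSpace HP] {IP : ModelWithCorners ℝ EP HP}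
    {P : Type*} [TopologicalSpace P] [ChartedSpace HP P] {h : M → P}
    (hh : ContMDiff 𝓘(ℝ, E') IP ∞ (h ∘ F)) : ContMDiff I IP ∞ h := by
  intro x
  obtain ⟨a, rfl⟩ := hF.surjective x
  obtain ⟨c, hc, hca, hFc⟩ := hF.exists_section a
  have : ContMDiffAt I IP ∞ ((h ∘ F) ∘ c) (F a) := (hh.contMDiffAt).comp (F a) hc
  refine this.congr_of_eventuallyEq ?_
  filter_upwards [hFc] with y hy
  simp [hy]

omit hF in
theorem mfderiv_apply_mfderiv_section {c : M → E'} {x : M}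
    (hF : MDifferentiableAt 𝓘(ℝ, E') I F (c x)) (hc : MDifferentiableAt I 𝓘(ℝ, E') c x)
    (hFc : ∀ᶠ y in 𝓝 x, F (c y) = y) (u : E) :
    (mfderiv 𝓘(ℝ, E') I F (c x) (mfderiv I 𝓘(ℝ, E') c x u) : E) = u := by
  have h : F ∘ c =ᶠ[𝓝 x] id := hFc
  have h1 := mfderiv_comp x hF hc
  have h2 := h.mfderiv_eq (I := I) (I' := I)
  have h3 : (mfderiv I I (F ∘ c) x u : E) = u := by
    rw [h2, mfderiv_id]; rfl
  rw [h1] at h3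
  exact h3

theorem surjective_mfderiv (a : E') : Function.Surjective (mfderiv 𝓘(ℝ, E') I F a) := by
  intro u
  obtain ⟨c, hc, hca, hFc⟩ := hF.exists_section a
  have := mfderiv_apply_mfderiv_section (hF.mdifferentiableAt (c (F a)))
    (hc.mdifferentiableAt (by simp)) hFc u
  rw [hca] at this
  exact ⟨_, this⟩

/-- A 1-form whose pull-back under `F` is `η` is the pull-back of `η` under the sections. -/
theorem form_eq_pullback_section {V : Type*} [NormedAddCommGroup V] [NormedSpace ℝ V]
    {θ : ∀ x : M, TangentSpace I x →L[ℝ] V} {η : E' → E' →L[ℝ] V}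
    (hθ : ∀ a u, θ (F a) (mfderiv 𝓘(ℝ, E') I F a u) = η a u)
    {c : M → E'} {x : M} (hc : MDifferentiableAt I 𝓘(ℝ, E') c x)
    (hFc : ∀ᶠ y in 𝓝 x, F (c y) = y) (u : TangentSpace I x) :
    θ x u = η (c x) (mfderiv I 𝓘(ℝ, E') c x u) := by
  rw [← hθ]
  have h := mfderiv_apply_mfderiv_section (hF.mdifferentiableAt (c x)) hc hFc u
  -- The tangent spaces at `F (c x)` and at `x` are both `E`, but the two points agree only
  -- propositionally; generalising point and vector together permits the substitution.
  have key : ∀ y, y = x → ∀ v : E, v = u → (θ x : E → V) u = (θ y : E → V) v := by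
    rintro _ rfl _ rfl; rfl
  exact key _ hFc.self_of_nhds _ h

end HasSmoothSections

/-- The bilinear form `∑ᵢ θᵢ ⊗ θᵢ`. -/
def sumSq {ι : Type*} [Fintype ι] {V : Type*} [AddCommGroup V] [TopologicalSpace V] [Module ℝ V]
    [IsTopologicalAddGroup V] [ContinuousConstSMul ℝ V]
    (θ : ι → V →L[ℝ] ℝ) : V →L[ℝ] V →L[ℝ] ℝ :=
  ∑ i, (θ i).smulRight (θ i)

theorem sumSq_apply {ι : Type*} [Fintype ι] {V : Type*} [AddCommGroup V] [TopologicalSpace V]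
    [Module ℝ V] [IsTopologicalAddGroup V] [ContinuousConstSMul ℝ V]
    (θ : ι → V →L[ℝ] ℝ) (u v : V) : sumSq θ u v = ∑ i, θ i u * θ i v := by
  simp [sumSq]

theorem contDiff_sumSq {ι : Type*} [Fintype ι] :
    ContDiff ℝ ∞ (sumSq : (ι → E →L[ℝ] ℝ) → E →L[ℝ] E →L[ℝ] ℝ) := by
  unfold sumSq
  fun_prop

/-- Near `F a` each `θ i` is the pull-back of `η i` under a smooth local section `c`. In tangent
coordinates it becomes `η i (c x)` composed with the smooth derivative of `c`, and `sumSq` is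
quadratic in its arguments. -/
theorem contMDiff_sumSq [IsManifold I ∞ M] {F : E' → M} (hF : HasSmoothSections I F)
    {ι : Type*} [Fintype ι] {θ : ι → ∀ x : M, TangentSpace I x →L[ℝ] ℝ}
    {η : ι → E' → E' →L[ℝ] ℝ} (hη : ∀ i, ContDiff ℝ ∞ (η i))
    (hθ : ∀ i a u, θ i (F a) (mfderiv 𝓘(ℝ, E') I F a u) = η i a u) :
    ContMDiff I (I.prod 𝓘(ℝ, E →L[ℝ] E →L[ℝ] ℝ)) ∞
      (fun x => TotalSpace.mk' (E →L[ℝ] E →L[ℝ] ℝ)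
        (E := fun x : M => TangentSpace I x →L[ℝ] TangentSpace I x →L[ℝ] ℝ) x
        (sumSq fun i => θ i x)) := by
  intro x₀
  obtain ⟨a, rfl⟩ := hF.surjective x₀
  obtain ⟨c, hc, hca, hFc⟩ := hF.exists_section a
  rw [contMDiffAt_hom_bundle]
  refine ⟨contMDiffAt_id, ?_⟩
  have hA := hc.mfderiv_const (m := ∞) (by simp)
  set A := inTangentCoordinates I 𝓘(ℝ, E') id c (mfderiv I 𝓘(ℝ, E') c) (F a) with hAdef
  have hη' : ∀ i, ContMDiffAt I 𝓘(ℝ, E →L[ℝ] ℝ) ∞ (fun x => (η i (c x)).comp (A x)) (F a) := by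
    intro i
    have h1 : ContMDiffAt I 𝓘(ℝ, E' →L[ℝ] ℝ) ∞ (fun x => η i (c x)) (F a) :=
      (hη i).contMDiff.contMDiffAt.comp (F a) hc
    exact h1.clm_comp hA
  have hS : ContMDiffAt I 𝓘(ℝ, E →L[ℝ] E →L[ℝ] ℝ) ∞
      (fun x => sumSq fun i => (η i (c x)).comp (A x)) (F a) := by
    exact contDiff_sumSq.contMDiff.contMDiffAt.comp (F a)
      (contMDiffAt_pi_space.mpr hη')
  refine hS.congr_of_eventuallyEq ?_
  have hmd : ∀ᶠ x in 𝓝 (F a), MDifferentiableAt I 𝓘(ℝ, E') c x := by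
    have h1 : ContMDiffAt I 𝓘(ℝ, E') 1 c (F a) := hc.of_le (by simp)
    filter_upwards [(contMDiffAt_iff_contMDiffAt_nhds (by simp)).mp h1] with x hx
    exact hx.mdifferentiableAt (by simp)
  have hsrc : ∀ᶠ x in 𝓝 (F a), x ∈ (chartAt H (F a)).source := chart_source_mem_nhds H (F a)
  filter_upwards [hFc.eventually_nhds, hmd, hsrc] with x hx1 hx2 hx3
  ext v w
  rw [inCoordinates_apply_eq₂ (by simpa using hx3) (by simpa using hx3) (by simp)]
  -- The tangent bundle of the vector space `E'` is trivialised by the identity, so only the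
  -- trivialisation on the side of `M` remains.
  have hAx : ∀ v : E, A x v = mfderiv I 𝓘(ℝ, E') c x
      ((trivializationAt E (TangentSpace I) (F a)).symm x v) := by
    intro v
    change (trivializationAt E' (TangentSpace 𝓘(ℝ, E')) (c (F a))).continuousLinearMapAt ℝ (c x)
      (mfderiv I 𝓘(ℝ, E') c x ((trivializationAt E (TangentSpace I) (F a)).symmL ℝ x v)) = _
    rw [TangentBundle.continuousLinearMapAt_model_space]
    rw [Trivialization.symmL_apply _ (by simpa using hx3)]
    rfl
  simp only [sumSq_apply, hF.form_eq_pullback_section (hθ _) hx2 hx1]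
  simp [hAx]

/-- The `θ i` together form an injective linear map on a finite-dimensional space. Such a map is
antilipschitz, so preimages of bounded sets are bounded. -/
theorem isVonNBounded_sumSq_lt_one [FiniteDimensional ℝ E] {ι : Type*} [Fintype ι]
    (θ : ι → E →L[ℝ] ℝ) (hθ : ∀ v, (∀ i, θ i v = 0) → v = 0) :
    Bornology.IsVonNBounded ℝ {v : E | sumSq θ v v < 1} := by
  rw [NormedSpace.isVonNBounded_iff]
  have hker : (ContinuousLinearMap.pi θ : E →L[ℝ] ι → ℝ).ker = ⊥ := by
    rw [LinearMap.ker_eq_bot']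
    exact fun v hv => hθ v fun i => congrFun hv i
  obtain ⟨K, -, hK⟩ := LinearMap.exists_antilipschitzWith (ContinuousLinearMap.pi θ).toLinearMap hker
  refine (hK.isBounded_preimage (Metric.isBounded_closedBall (x := 0) (r := 1))).subset ?_
  intro v hv
  simp only [Set.mem_preimage, mem_closedBall_zero_iff]
  refine (pi_norm_le_iff_of_nonneg zero_le_one).mpr fun i => ?_
  rw [Set.mem_ofPred_eq, sumSq_apply] at hv
  have : θ i v * θ i v ≤ ∑ i, θ i v * θ i v :=
    Finset.single_le_sum (f := fun i => θ i v * θ i v) (fun i _ => mul_self_nonneg _)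
      (Finset.mem_univ i)
  change |θ i v| ≤ 1
  rw [abs_le_one_iff_mul_self_le_one]
  linarith

/-- The smooth Riemannian metric `∑ᵢ θᵢ ⊗ θᵢ`, for 1-forms `θᵢ` without common zeros whose
pull-backs under `F` are the smooth 1-forms `ηᵢ`. -/
def metricOfForms [FiniteDimensional ℝ E] [IsManifold I ∞ M] {F : E' → M}
    (hF : HasSmoothSections I F) {ι : Type*} [Fintype ι]
    (θ : ι → ∀ x : M, TangentSpace I x →L[ℝ] ℝ) {η : ι → E' → E' →L[ℝ] ℝ}
    (hη : ∀ i, ContDiff ℝ ∞ (η i))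
    (hθ : ∀ i a u, θ i (F a) (mfderiv 𝓘(ℝ, E') I F a u) = η i a u)
    (hpos : ∀ (x : M) (v : TangentSpace I x), (∀ i, θ i x v = 0) → v = 0) :
    ContMDiffRiemannianMetric I ∞ E (fun x : M => TangentSpace I x) where
  inner x := sumSq fun i => θ i x
  symm x v w := by simp only [sumSq_apply, mul_comm]
  pos x v hv := by
    rw [sumSq_apply]
    by_contra! h
    refine hv (hpos x v fun i => ?_)
    have h0 := (Finset.sum_eq_zero_iff_of_nonneg (fun i _ => mul_self_nonneg (θ i x v))).mp
      (le_antisymm h (Finset.sum_nonneg fun i _ => mul_self_nonneg (θ i x v))) i (Finset.mem_univ i)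
    exact mul_self_eq_zero.mp h0
  isVonNBounded x := isVonNBounded_sumSq_lt_one (E := E) (fun i => θ i x) (hpos x)
  contMDiff := contMDiff_sumSq hF hη hθ

theorem metricOfForms_inner [FiniteDimensional ℝ E] [IsManifold I ∞ M] {F : E' → M}
    (hF : HasSmoothSections I F) {ι : Type*} [Fintype ι]
    {θ : ι → ∀ x : M, TangentSpace I x →L[ℝ] ℝ} {η : ι → E' → E' →L[ℝ] ℝ}
    (hη : ∀ i, ContDiff ℝ ∞ (η i))
    (hθ : ∀ i a u, θ i (F a) (mfderiv 𝓘(ℝ, E') I F a u) = η i a u)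
    (hpos : ∀ (x : M) (v : TangentSpace I x), (∀ i, θ i x v = 0) → v = 0) (x : M)
    (u v : TangentSpace I x) :
    (metricOfForms hF θ hη hθ hpos).inner x u v = ∑ i, θ i x u * θ i x v :=
  sumSq_apply _ _ _

end Sections

/-! ### Riemannian distances and their comparison under maps. -/

section Distance

variable {E : Type*} [NormedAddCommGroup E] [NormedSpace ℝ E]
  {H : Type*} [TopologicalSpace H] {I : ModelWithCorners ℝ E H}
  {M : Type*} [TopologicalSpace M] [ChartedSpace H M] [IsManifold I 1 M]
  {EP : Type*} [NormedAddCommGroup EP] [NormedSpace ℝ EP]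
  {HP : Type*} [TopologicalSpace HP] {IP : ModelWithCorners ℝ EP HP}
  {P : Type*} [TopologicalSpace P] [ChartedSpace HP P] [IsManifold IP 1 P]

/-- The Riemannian extended distance of a smooth Riemannian metric. -/
def riemEDist (g : ContMDiffRiemannianMetric I ∞ E (fun x : M => TangentSpace I x)) (x y : M) :
    ENNReal :=
  letI : RiemannianBundle (fun x : M => TangentSpace I x) := ⟨g.toRiemannianMetric⟩
  Manifold.riemannianEDist I x y

theorem enorm_eq_ofReal_sqrt
    (g : ContMDiffRiemannianMetric I ∞ E (fun x : M => TangentSpace I x)) (x : M)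
    (v : TangentSpace I x) :
    let : RiemannianBundle (fun x : M => TangentSpace I x) := ⟨g.toRiemannianMetric⟩
    ‖v‖ₑ = ENNReal.ofReal √(g.inner x v v) := by
  intro
  rw [← ofReal_norm, norm_eq_sqrt_real_inner]
  rfl

theorem riemEDist_triangle (g : ContMDiffRiemannianMetric I ∞ E (fun x : M => TangentSpace I x))
    (x y z : M) : riemEDist g x z ≤ riemEDist g x y + riemEDist g y z :=
  letI : RiemannianBundle (fun x : M => TangentSpace I x) := ⟨g.toRiemannianMetric⟩
  Manifold.riemannianEDist_triangle

theorem riemEDist_comm (g : ContMDiffRiemannianMetric I ∞ E (fun x : M => TangentSpace I x))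
    (x y : M) : riemEDist g x y = riemEDist g y x :=
  letI : RiemannianBundle (fun x : M => TangentSpace I x) := ⟨g.toRiemannianMetric⟩
  Manifold.riemannianEDist_comm

/-- A `C¹` map that does not increase the length of tangent vectors does not increase the
Riemannian distance. -/
theorem riemEDist_map_le (g : ContMDiffRiemannianMetric I ∞ E (fun x : M => TangentSpace I x))
    (g' : ContMDiffRiemannianMetric IP ∞ EP (fun x : P => TangentSpace IP x)) {f : M → P}
    (hf : ContMDiff I IP 1 f)
    (h : ∀ (x : M) (u : TangentSpace I x),
      g'.inner (f x) (mfderiv I IP f x u) (mfderiv I IP f x u) ≤ g.inner x u u) (x y : M) :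
    riemEDist g' (f x) (f y) ≤ riemEDist g x y := by
  let : RiemannianBundle (fun x : M => TangentSpace I x) := ⟨g.toRiemannianMetric⟩
  let : RiemannianBundle (fun x : P => TangentSpace IP x) := ⟨g'.toRiemannianMetric⟩
  refine le_of_forall_gt fun r hr => ?_
  obtain ⟨γ, h0, h1, hγ, hl⟩ := Manifold.exists_lt_of_riemannianEDist_lt hr
  refine lt_of_le_of_lt ?_ hl
  refine (Manifold.riemannianEDist_le_pathELength (γ := f ∘ γ) (hf.comp_contMDiffOn hγ)
    (by simp [h0]) (by simp [h1]) zero_le_one).trans ?_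
  -- The path is C¹ only on the closed interval, so the chain rule for `mfderiv` is available at
  -- interior points; the endpoints have measure zero.
  rw [Manifold.pathELength_eq_lintegral_mfderiv_Ioo, Manifold.pathELength_eq_lintegral_mfderiv_Ioo]
  refine MeasureTheory.setLIntegral_mono' measurableSet_Ioo fun t ht => ?_
  have hγt : MDifferentiableAt 𝓘(ℝ, ℝ) I γ t :=
    ((hγ t ⟨ht.1.le, ht.2.le⟩).contMDiffAt (Icc_mem_nhds ht.1 ht.2)).mdifferentiableAt (by simp)
  rw [mfderiv_comp t (hf.mdifferentiableAt (by simp)) hγt, enorm_eq_ofReal_sqrt g,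
    enorm_eq_ofReal_sqrt g']
  exact ENNReal.ofReal_le_ofReal (Real.sqrt_le_sqrt (h _ _))

/-- The distance between the ends of the image of a segment along which the speed is at most
`K`. -/
theorem riemEDist_image_segment_le
    (g : ContMDiffRiemannianMetric I ∞ E (fun x : M => TangentSpace I x))
    {E' : Type*} [NormedAddCommGroup E'] [NormedSpace ℝ E'] {F : E' → M}
    (hF : ContMDiff 𝓘(ℝ, E') I ∞ F) (a v : E') {K : ℝ} (hK : 0 ≤ K)
    (h : ∀ t ∈ Set.Icc (0 : ℝ) 1, g.inner (F (a + t • v)) (mfderiv 𝓘(ℝ, E') I F (a + t • v) v)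
      (mfderiv 𝓘(ℝ, E') I F (a + t • v) v) ≤ K ^ 2) :
    riemEDist g (F a) (F (a + v)) ≤ ENNReal.ofReal K := by
  let : RiemannianBundle (fun x : M => TangentSpace I x) := ⟨g.toRiemannianMetric⟩
  have hl : ContDiff ℝ ∞ fun t : ℝ => a + t • v := by fun_prop
  refine (Manifold.riemannianEDist_le_pathELength (γ := F ∘ fun t : ℝ => a + t • v) (a := 0) (b := 1)
    ((hF.comp hl.contMDiff).of_le (by simp)).contMDiffOn (by simp) (by simp) zero_le_one).trans ?_
  rw [Manifold.pathELength_eq_lintegral_mfderiv_Icc]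
  calc _ ≤ ∫⁻ _ in Set.Icc (0 : ℝ) 1, ENNReal.ofReal K := by
        refine MeasureTheory.setLIntegral_mono' measurableSet_Icc fun t ht => ?_
        have hd : HasDerivAt (fun t : ℝ => a + t • v) v t := by
          simpa using ((hasDerivAt_id t).smul_const v).const_add a
        have h1 : (mfderiv 𝓘(ℝ, ℝ) 𝓘(ℝ, E') (fun t : ℝ => a + t • v) t (1 : ℝ) : E') = v := by
          rw [mfderiv_eq_fderiv]
          exact hd.deriv
        rw [mfderiv_comp t (hF.mdifferentiableAt (by simp)) (hl.contMDiff.mdifferentiableAt (by simp)),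
          enorm_eq_ofReal_sqrt g]
        refine ENNReal.ofReal_le_ofReal (Real.sqrt_le_iff.mpr ⟨hK, ?_⟩)
        have key : ∀ w : E', w = v →
            g.inner (F (a + t • v)) (mfderiv 𝓘(ℝ, E') I F (a + t • v) w)
              (mfderiv 𝓘(ℝ, E') I F (a + t • v) w) ≤ K ^ 2 := by
          rintro _ rfl
          exact h t ht
        exact key _ h1
    _ = ENNReal.ofReal K := by simp

/-- Finiteness turns the extended distance into a distance; the separation hypothesis serves to make
the Riemannian distance a metric inducing the given topology. -/
theorem exists_isRiemannianDistance [T3Space M]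
    (g : ContMDiffRiemannianMetric I ∞ E (fun x : M => TangentSpace I x))
    (hg : ∀ x y, riemEDist g x y ≠ ⊤) : ∃ d : MetricSpace M, IsRiemannianDistance g d := by
  let : RiemannianBundle (fun x : M => TangentSpace I x) := ⟨g.toRiemannianMetric⟩
  have : IsContinuousRiemannianBundle E (fun x : M => TangentSpace I x) :=
    ⟨g.inner, g.contMDiff.continuous, fun _ _ _ => rfl⟩
  let : EMetricSpace M := .ofRiemannianMetric I M
  exact ⟨EMetricSpace.toMetricSpace hg, rfl, fun x y => rfl⟩

end Distance

/-! ### Smoothness and descent of forms for quotients by deck transformations. -/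

section Quotient

variable {E : Type*} [NormedAddCommGroup E] [NormedSpace ℝ E] {X : Type*} [TopologicalSpace X]
  {f : E → X} {s : X → E}

/-- By construction of the atlas, this local inverse is the preferred chart at `x`. -/
theorem contMDiffAt_localInverseAt (hf : IsLocalHomeomorph f) (hs : Function.RightInverse s f)
    (hT : ∀ a b, f a = f b → ∃ T : E → E, ContDiff ℝ ∞ T ∧ (∀ z, f (T z) = f z) ∧ T a = b)
    (x : X) :
    letI := hf.chartedSpaceOfRightInverse (H := E) hs
    ContMDiffAt 𝓘(ℝ, E) 𝓘(ℝ, E) ∞ (hf.localInverseAt (s x)) x := by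
  let _ := hf.chartedSpaceOfRightInverse (H := E) hs
  have : IsManifold 𝓘(ℝ, E) ∞ X := isManifold_of_isLocalHomeomorph hf hs hT
  have h := contMDiffAt_extChartAt (I := 𝓘(ℝ, E)) (n := ∞) (x := x)
  exact h

theorem contMDiff_of_isLocalHomeomorph (hf : IsLocalHomeomorph f) (hs : Function.RightInverse s f)
    (hT : ∀ a b, f a = f b → ∃ T : E → E, ContDiff ℝ ∞ T ∧ (∀ z, f (T z) = f z) ∧ T a = b) :
    letI := hf.chartedSpaceOfRightInverse (H := E) hs
    ContMDiff 𝓘(ℝ, E) 𝓘(ℝ, E) ∞ f := by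
  let _ := hf.chartedSpaceOfRightInverse (H := E) hs
  have : IsManifold 𝓘(ℝ, E) ∞ X := isManifold_of_isLocalHomeomorph hf hs hT
  intro a
  -- The chart at `f a` inverts `f` around the chosen lift `s (f a)`, not around `a`. With `T`
  -- moving `a` to that lift, `f` is the inverse chart composed with `T`.
  obtain ⟨T, hTs, hTf, hTa⟩ := hT a (s (f a)) (hs (f a)).symm
  have h1 : ContMDiffAt 𝓘(ℝ, E) 𝓘(ℝ, E) ∞ (extChartAt 𝓘(ℝ, E) (f a)).symm
      (extChartAt 𝓘(ℝ, E) (f a) (f a)) :=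
    (contMDiffOn_extChartAt_symm (f a)).contMDiffAt (extChartAt_target_mem_nhds (f a))
  have h2 : extChartAt 𝓘(ℝ, E) (f a) (f a) = T a := by
    have : hf.localInverseAt (s (f a)) (f (s (f a))) = s (f a) := by simp
    rw [hs (f a)] at this
    rw [hTa]
    exact this
  rw [h2] at h1
  refine (h1.comp a hTs.contMDiff.contMDiffAt).congr_of_eventuallyEq (Eventually.of_forall fun z => ?_)
  rw [← hTf]
  exact (congrFun (hf.localInverseAt_symm (x := s (f a))) (T z)).symm

/-- The section through `a` is the chart at `f a` followed by a deck transformation carrying the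
chosen lift to `a`. -/
theorem hasSmoothSections_of_isLocalHomeomorph (hf : IsLocalHomeomorph f)
    (hs : Function.RightInverse s f)
    (hT : ∀ a b, f a = f b → ∃ T : E → E, ContDiff ℝ ∞ T ∧ (∀ z, f (T z) = f z) ∧ T a = b) :
    letI := hf.chartedSpaceOfRightInverse (H := E) hs
    HasSmoothSections 𝓘(ℝ, E) f := by
  let _ := hf.chartedSpaceOfRightInverse (H := E) hs
  refine ⟨contMDiff_of_isLocalHomeomorph hf hs hT, hs.surjective, fun a => ?_⟩
  obtain ⟨T, hTs, hTf, hTa⟩ := hT (s (f a)) a (hs (f a))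
  refine ⟨T ∘ hf.localInverseAt (s (f a)), ?_, ?_, ?_⟩
  · exact hTs.contMDiff.contMDiffAt.comp _ (contMDiffAt_localInverseAt hf hs hT (f a))
  · have : hf.localInverseAt (s (f a)) (f (s (f a))) = s (f a) := by simp
    rw [hs (f a)] at this
    simp [this, hTa]
  · have : (hf.localInverseAt (s (f a))).source ∈ 𝓝 (f a) := by
      refine (hf.localInverseAt (s (f a))).open_source.mem_nhds ?_
      simpa [hs (f a)] using hf.apply_self_mem_localInverseAt_source (x := s (f a))
    filter_upwards [this] with x hx
    simp only [Function.comp_apply, hTf]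
    exact hf.apply_localInverseAt_of_mem hx

/-- The pull-back of `descend hf s η` under `f` is `η`, if `η` is invariant. -/
theorem descend_apply_mfderiv {V : Type*} [NormedAddCommGroup V] [NormedSpace ℝ V]
    (hf : IsLocalHomeomorph f) (hs : Function.RightInverse s f)
    {η : E → E →L[ℝ] V}
    (hT : ∀ a b, f a = f b → ∃ T : E → E, (ContDiff ℝ ∞ T ∧ (∀ z, f (T z) = f z) ∧ T a = b) ∧
      ∀ z u, η (T z) (fderiv ℝ T z u) = η z u) (a u : E) :
    letI := hf.chartedSpaceOfRightInverse (H := E) hs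
    descend hf s η (f a) (mfderiv 𝓘(ℝ, E) 𝓘(ℝ, E) f a u) = η a u := by
  let _ := hf.chartedSpaceOfRightInverse (H := E) hs
  have hT' : ∀ a b, f a = f b →
      ∃ T : E → E, ContDiff ℝ ∞ T ∧ (∀ z, f (T z) = f z) ∧ T a = b :=
    fun a b hab => (hT a b hab).imp fun T h => h.1
  obtain ⟨T, ⟨hTs, hTf, hTa⟩, hη⟩ := hT a (s (f a)) (hs (f a)).symm
  set c := hf.localInverseAt (s (f a)) with hc
  have hcs : c.symm = f := hf.localInverseAt_symm _
  -- The chart composed with `f` is locally the deck transformation `T`, so pulling back the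
  -- descended form amounts to pulling back `η` under `T`, which leaves it unchanged.
  have hcT : ∀ᶠ z in 𝓝 a, c (f z) = T z := by
    have : T ⁻¹' c.target ∈ 𝓝 a :=
      (c.open_target.preimage hTs.continuous).mem_nhds (by simp [hTa, hc])
    filter_upwards [this] with z hz
    rw [← hTf z, ← hcs, c.right_inv hz]
  have h1 := mfderiv_comp (I := 𝓘(ℝ, E)) (I' := 𝓘(ℝ, E)) (I'' := 𝓘(ℝ, E)) a
    ((contMDiffAt_localInverseAt hf hs hT' (f a)).mdifferentiableAt (by simp))
    ((contMDiff_of_isLocalHomeomorph hf hs hT').mdifferentiableAt (x := a) (by simp))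
  have h2 : (⇑(hf.localInverseAt (s (f a))) ∘ f) =ᶠ[𝓝 a] T := hcT
  rw [h2.mfderiv_eq, mfderiv_eq_fderiv] at h1
  rw [← hη a u, ← hcT.self_of_nhds]
  exact congrArg (η (c (f a))) (DFunLike.congr_fun h1 u).symm

end Quotient

/-! ### `X`, the circles and `N` -/

/-- Right translation by δ = a⁻¹b multiplies dw² by e^(-δ¹) and dw³ by e^(δ¹). The coefficients
e^(w¹) and e^(-w¹) change by the inverse factors, whence the invariance of the Θ's. -/
theorem exists_deck_X (a b : ℂ × ℂ × ℂ) (hab : toX a = toX b) : ∃ T : ℂ × ℂ × ℂ → ℂ × ℂ × ℂ,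
    (ContDiff ℝ ∞ T ∧ (∀ z, toX (T z) = toX z) ∧ T a = b) ∧
      ∀ i z u, ThetaH i (T z) (fderiv ℝ T z u) = ThetaH i z u := by
  have h := QuotientGroup.eq.mp hab
  set δ : H := (H.coordsHomeo.symm a)⁻¹ * H.coordsHomeo.symm b
  refine ⟨fun z => (z.1 + δ.w1, Complex.exp (-δ.w1) * z.2.1 + δ.w2,
    Complex.exp δ.w1 * z.2.2 + δ.w3), ⟨by fun_prop, fun z => ?_, ?_⟩, fun i z u => ?_⟩
  · exact (QuotientGroup.mk_mul_of_mem (H.coordsHomeo.symm z) h :)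
  · exact congrArg H.coordsHomeo (mul_inv_cancel_left (H.coordsHomeo.symm a) _)
  · have hd : HasFDerivAt (𝕜 := ℝ) (fun z : ℂ × ℂ × ℂ => (z.1 + δ.w1,
        Complex.exp (-δ.w1) * z.2.1 + δ.w2, Complex.exp δ.w1 * z.2.2 + δ.w3))
        ((dw 0).prod ((Complex.exp (-δ.w1) • dw 1).prod (Complex.exp δ.w1 • dw 2))) z := by
      have h0 : HasFDerivAt (𝕜 := ℝ) (fun z : ℂ × ℂ × ℂ => z.1) (dw 0) z := (dw 0).hasFDerivAt
      have h1 : HasFDerivAt (𝕜 := ℝ) (fun z : ℂ × ℂ × ℂ => z.2.1) (dw 1) z := (dw 1).hasFDerivAt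
      have h2 : HasFDerivAt (𝕜 := ℝ) (fun z : ℂ × ℂ × ℂ => z.2.2) (dw 2) z := (dw 2).hasFDerivAt
      exact (h0.add_const _).prodMk (((h1.const_mul _).add_const _).prodMk
        ((h2.const_mul _).add_const _))
    rw [hd.fderiv]
    fin_cases i
    · simp [ThetaH, dw]
    · simp [ThetaH, dw, Complex.exp_add, Complex.exp_neg]
      field_simp
    · simp [ThetaH, dw, Complex.exp_add, Complex.exp_neg]
      field_simp

theorem hasSmoothSections_toX : HasSmoothSections 𝓘(ℝ, ℂ × ℂ × ℂ) toX :=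
  hasSmoothSections_of_isLocalHomeomorph isLocalHomeomorph_toX rightInverse_liftX
    fun a b hab => (exists_deck_X a b hab).imp fun _ h => h.1

theorem ThetaX_apply_mfderiv (i : Fin 3) (a u : ℂ × ℂ × ℂ) :
    ThetaX i (toX a) (mfderiv 𝓘(ℝ, ℂ × ℂ × ℂ) 𝓘(ℝ, ℂ × ℂ × ℂ) toX a u) = ThetaH i a u :=
  descend_apply_mfderiv isLocalHomeomorph_toX rightInverse_liftX
    (fun a b hab => (exists_deck_X a b hab).imp fun _ h => ⟨h.1, h.2 i⟩) a u

theorem exists_deck_circle (T : ℝ) (a b : ℝ) (hab : (a : AddCircle T) = b) : ∃ S : ℝ → ℝ,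
    (ContDiff ℝ ∞ S ∧ (∀ z, (S z : AddCircle T) = z) ∧ S a = b) ∧
      ∀ z u, ContinuousLinearMap.id ℝ ℝ (fderiv ℝ S z u) = ContinuousLinearMap.id ℝ ℝ u := by
  refine ⟨fun z => z + (b - a), ⟨by fun_prop, fun z => ?_, by ring⟩, fun z u => ?_⟩
  · rw [AddCircle.coe_add, AddCircle.coe_sub, hab]; simp
  · simp [fderiv_add_const]

theorem hasSmoothSections_coe_circle (T : ℝ) :
    HasSmoothSections 𝓘(ℝ, ℝ) ((↑) : ℝ → AddCircle T) :=
  hasSmoothSections_of_isLocalHomeomorph (AddCircle.isLocalHomeomorph_coe T)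
    (rightInverse_liftCircle T) fun a b hab => (exists_deck_circle T a b hab).imp fun _ h => h.1

theorem dt_apply_mfderiv (T a u : ℝ) :
    dt T (a : AddCircle T) (mfderiv 𝓘(ℝ, ℝ) 𝓘(ℝ, ℝ) ((↑) : ℝ → AddCircle T) a u) = u :=
  descend_apply_mfderiv (AddCircle.isLocalHomeomorph_coe T) (rightInverse_liftCircle T)
    (exists_deck_circle T) a u

/-- The covering `ℂ³ × ℝ → N`. -/
def toN (a : (ℂ × ℂ × ℂ) × ℝ) : N := (toX a.1, (a.2 : AddCircle (2 * Real.pi)))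

theorem hasSmoothSections_toN : HasSmoothSections IN toN where
  contMDiff := (hasSmoothSections_toX.contMDiff.comp contDiff_fst.contMDiff).prodMk
    ((hasSmoothSections_coe_circle _).contMDiff.comp contDiff_snd.contMDiff)
  surjective := Function.Surjective.prodMap hasSmoothSections_toX.surjective
    (hasSmoothSections_coe_circle _).surjective
  exists_section a := by
    obtain ⟨c, hc, hca, hc'⟩ := hasSmoothSections_toX.exists_section a.1
    obtain ⟨d, hd, hda, hd'⟩ := (hasSmoothSections_coe_circle (2 * Real.pi)).exists_section a.2
    refine ⟨fun x => (c x.1, d x.2), ?_, ?_, ?_⟩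
    · exact (hc.comp (toN a) contMDiffAt_fst).prodMk_space (hd.comp (toN a) contMDiffAt_snd)
    · exact Prod.ext hca hda
    · have h1 : ∀ᶠ x : N in 𝓝 (toN a), toX (c x.1) = x.1 :=
        (continuousAt_fst (p := toN a)).eventually hc'
      have h2 : ∀ᶠ x : N in 𝓝 (toN a), ((d x.2 : ℝ) : AddCircle (2 * Real.pi)) = x.2 :=
        (continuousAt_snd (p := toN a)).eventually hd'
      filter_upwards [h1, h2] with x h1 h2
      exact Prod.ext h1 h2

/-- The chain rule applied to both sides of `Prod.fst ∘ toN = toX ∘ Prod.fst` reduces this to the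
statement on `X`. -/
theorem Theta_apply_mfderiv (i : Fin 3) (a u : (ℂ × ℂ × ℂ) × ℝ) :
    Theta i (toN a) (mfderiv 𝓘(ℝ, (ℂ × ℂ × ℂ) × ℝ) IN toN a u) = ThetaH i a.1 u.1 := by
  have h1 := mfderiv_comp (I := 𝓘(ℝ, (ℂ × ℂ × ℂ) × ℝ)) (I' := IN) (I'' := 𝓘(ℝ, ℂ × ℂ × ℂ)) a
    (g := Prod.fst) (mdifferentiableAt_fst) (hasSmoothSections_toN.mdifferentiableAt a)
  have h2 := mfderiv_comp (I := 𝓘(ℝ, (ℂ × ℂ × ℂ) × ℝ)) (I' := 𝓘(ℝ, ℂ × ℂ × ℂ))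
    (I'' := 𝓘(ℝ, ℂ × ℂ × ℂ)) a (g := toX) (f := Prod.fst)
    (hasSmoothSections_toX.mdifferentiableAt a.1)
    (differentiableAt_fst (𝕜 := ℝ)).mdifferentiableAt
  have h3 : (Prod.fst ∘ toN) = toX ∘ Prod.fst := rfl
  rw [h3, h2] at h1
  rw [← ThetaX_apply_mfderiv]
  refine congrArg (ThetaX i (toX a.1)) ((DFunLike.congr_fun h1 u).symm.trans ?_)
  have : mfderiv 𝓘(ℝ, (ℂ × ℂ × ℂ) × ℝ) 𝓘(ℝ, ℂ × ℂ × ℂ) Prod.fst a =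
      ContinuousLinearMap.fst ℝ (ℂ × ℂ × ℂ) ℝ := by
    rw [mfderiv_eq_fderiv]; exact fderiv_fst
  rw [this]
  rfl

theorem g3_apply_mfderiv (a u : (ℂ × ℂ × ℂ) × ℝ) :
    g3 (toN a) (mfderiv 𝓘(ℝ, (ℂ × ℂ × ℂ) × ℝ) IN toN a u) = u.2 := by
  have h1 := mfderiv_comp (I := 𝓘(ℝ, (ℂ × ℂ × ℂ) × ℝ)) (I' := IN) (I'' := 𝓘(ℝ, ℝ)) a
    (g := Prod.snd) (mdifferentiableAt_snd) (hasSmoothSections_toN.mdifferentiableAt a)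
  have h2 := mfderiv_comp (I := 𝓘(ℝ, (ℂ × ℂ × ℂ) × ℝ)) (I' := 𝓘(ℝ, ℝ))
    (I'' := 𝓘(ℝ, ℝ)) a (g := ((↑) : ℝ → AddCircle (2 * Real.pi))) (f := Prod.snd)
    ((hasSmoothSections_coe_circle _).mdifferentiableAt a.2)
    (differentiableAt_snd (𝕜 := ℝ)).mdifferentiableAt
  have h3 : (Prod.snd ∘ toN) = ((↑) : ℝ → AddCircle (2 * Real.pi)) ∘ Prod.snd := rfl
  rw [h3, h2] at h1
  rw [← dt_apply_mfderiv (2 * Real.pi) a.2 u.2]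
  refine congrArg (dt (2 * Real.pi) (a.2 : AddCircle (2 * Real.pi)))
    ((DFunLike.congr_fun h1 u).symm.trans ?_)
  have : mfderiv 𝓘(ℝ, (ℂ × ℂ × ℂ) × ℝ) 𝓘(ℝ, ℝ) Prod.snd a =
      ContinuousLinearMap.snd ℝ (ℂ × ℂ × ℂ) ℝ := by
    rw [mfderiv_eq_fderiv]; exact fderiv_snd
  rw [this]
  rfl

/-! ### The fibration and its section -/

theorem proj_toN (a : (ℂ × ℂ × ℂ) × ℝ) : proj (toN a) = (a.1.1.re : AddCircle ell) := rfl

theorem contMDiff_proj : ContMDiff IN 𝓘(ℝ, ℝ) ∞ proj := by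
  refine hasSmoothSections_toN.contMDiff_of_comp ?_
  have h : ContDiff ℝ ∞ fun a : (ℂ × ℂ × ℂ) × ℝ => Complex.reCLM a.1.1 := by fun_prop
  exact (hasSmoothSections_coe_circle ell).contMDiff.comp h.contMDiff

theorem mfderiv_proj_mfderiv_toN (a u : (ℂ × ℂ × ℂ) × ℝ) :
    mfderiv IN 𝓘(ℝ, ℝ) proj (toN a) (mfderiv 𝓘(ℝ, (ℂ × ℂ × ℂ) × ℝ) IN toN a u) =
      mfderiv 𝓘(ℝ, ℝ) 𝓘(ℝ, ℝ) ((↑) : ℝ → AddCircle ell) a.1.1.re u.1.1.re := by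
  set L : (ℂ × ℂ × ℂ) × ℝ →L[ℝ] ℝ := Complex.reCLM.comp
    ((ContinuousLinearMap.fst ℝ ℂ (ℂ × ℂ)).comp (ContinuousLinearMap.fst ℝ (ℂ × ℂ × ℂ) ℝ))
  have h1 := mfderiv_comp a (contMDiff_proj.mdifferentiableAt (by simp))
    (hasSmoothSections_toN.mdifferentiableAt a)
  have h2 := mfderiv_comp (I := 𝓘(ℝ, (ℂ × ℂ × ℂ) × ℝ)) a
    ((hasSmoothSections_coe_circle ell).mdifferentiableAt (L a))
    L.differentiableAt.mdifferentiableAt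
  have h3 : proj ∘ toN = ((↑) : ℝ → AddCircle ell) ∘ L := rfl
  rw [h3, h2] at h1
  refine (DFunLike.congr_fun h1 u).symm.trans ?_
  have : mfderiv 𝓘(ℝ, (ℂ × ℂ × ℂ) × ℝ) 𝓘(ℝ, ℝ) L a = L := by
    rw [mfderiv_eq_fderiv]; exact L.fderiv
  rw [this]
  rfl

theorem surjective_proj : Function.Surjective proj := by
  intro t
  obtain ⟨s, rfl⟩ := (hasSmoothSections_coe_circle ell).surjective t
  exact ⟨toN ((s, 0, 0), 0), by simp [proj_toN]⟩

theorem surjective_mfderiv_proj (x : N) : Function.Surjective (mfderiv IN 𝓘(ℝ, ℝ) proj x) := by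
  obtain ⟨a, rfl⟩ := hasSmoothSections_toN.surjective x
  intro w
  obtain ⟨r, hr⟩ : ∃ r : ℝ, mfderiv 𝓘(ℝ, ℝ) 𝓘(ℝ, ℝ) ((↑) : ℝ → AddCircle ell) a.1.1.re r = w :=
    (hasSmoothSections_coe_circle ell).surjective_mfderiv a.1.1.re w
  refine ⟨_, (mfderiv_proj_mfderiv_toN a (((r : ℂ), 0, 0), 0)).trans ?_⟩
  exact hr

theorem toX_mul_of_mem (w : ℂ × ℂ × ℂ) {δ : H} (hδ : δ ∈ Delta) :
    toX (w.1 + δ.w1, Complex.exp (-δ.w1) * w.2.1 + δ.w2, Complex.exp δ.w1 * w.2.2 + δ.w3) =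
      toX w :=
  QuotientGroup.mk_mul_of_mem (H.coordsHomeo.symm w) hδ

/-- The first generator translates (s, 0, 0) on the right to (s + ℓ, 0, 0). -/
theorem toN_section_periodic :
    Function.Periodic (fun s : ℝ => toN (((s : ℂ), 0, 0), 0)) ell := by
  intro s
  refine Prod.ext ?_ rfl
  have hmem : latticeGen 0 ∈ Delta := Subgroup.subset_closure ⟨0, rfl⟩
  simpa [latticeGen, toN] using toX_mul_of_mem ((s : ℂ), 0, 0) hmem

/-- The section `s ↦ ([s, 0, 0], 0)` of `proj`. -/
def sec (t : AddCircle ell) : N := toN_section_periodic.lift t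

theorem sec_coe (s : ℝ) : sec (s : AddCircle ell) = toN (((s : ℂ), 0, 0), 0) := rfl

theorem proj_sec (t : AddCircle ell) : proj (sec t) = t := by
  obtain ⟨s, rfl⟩ := (hasSmoothSections_coe_circle ell).surjective t
  simp [sec_coe, proj_toN]

/-- The lift of `sec` to the universal coverings. -/
def secLift : ℝ →L[ℝ] (ℂ × ℂ × ℂ) × ℝ := ((Complex.ofRealCLM.prod 0).prod 0)

theorem sec_comp_coe : sec ∘ ((↑) : ℝ → AddCircle ell) = toN ∘ secLift := rfl

theorem contMDiff_sec : ContMDiff 𝓘(ℝ, ℝ) IN ∞ sec := by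
  refine (hasSmoothSections_coe_circle ell).contMDiff_of_comp ?_
  rw [sec_comp_coe]
  exact hasSmoothSections_toN.contMDiff.comp secLift.contDiff.contMDiff

theorem mfderiv_sec_mfderiv_coe (s r : ℝ) :
    mfderiv 𝓘(ℝ, ℝ) IN sec (s : AddCircle ell)
        (mfderiv 𝓘(ℝ, ℝ) 𝓘(ℝ, ℝ) ((↑) : ℝ → AddCircle ell) s r) =
      mfderiv 𝓘(ℝ, (ℂ × ℂ × ℂ) × ℝ) IN toN (secLift s) (secLift r) := by
  have h1 := mfderiv_comp s (contMDiff_sec.mdifferentiableAt (by simp))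
    ((hasSmoothSections_coe_circle ell).mdifferentiableAt s)
  have h2 := mfderiv_comp (I := 𝓘(ℝ, ℝ)) s (hasSmoothSections_toN.mdifferentiableAt (secLift s))
    secLift.differentiableAt.mdifferentiableAt
  rw [sec_comp_coe, h2] at h1
  refine (DFunLike.congr_fun h1 r).symm.trans ?_
  have : mfderiv 𝓘(ℝ, ℝ) 𝓘(ℝ, (ℂ × ℂ × ℂ) × ℝ) secLift s = secLift := by
    rw [mfderiv_eq_fderiv]; exact secLift.fderiv
  rw [this]
  rfl

/-! ### A bounded fundamental domain -/

/-- The one-parameter subgroup of `H` in the direction of the first coordinate. -/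
def baseHom : Multiplicative ℂ →* H where
  toFun z := ⟨z.toAdd, 0, 0⟩
  map_one' := rfl
  map_mul' u v := by simp [H.mul_def]

/-- The subgroup of `H` of the points with vanishing first coordinate. -/
def fibreHom : Multiplicative (ℂ × ℂ) →* H where
  toFun v := ⟨0, v.toAdd.1, v.toAdd.2⟩
  map_one' := rfl
  map_mul' u v := by simp [H.mul_def]

theorem base_mem_Delta (k j : ℤ) :
    (⟨k * ell + 2 * Real.pi * Complex.I * j, 0, 0⟩ : H) ∈ Delta := by
  have h0 : baseHom (.ofAdd (ell : ℂ)) ∈ Delta := Subgroup.subset_closure ⟨0, rfl⟩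
  have h1 : baseHom (.ofAdd (2 * Real.pi * Complex.I)) ∈ Delta :=
    Subgroup.subset_closure ⟨1, rfl⟩
  convert Delta.mul_mem (Delta.zpow_mem h0 k) (Delta.zpow_mem h1 j) using 1
  rw [← map_zpow baseHom, ← map_zpow baseHom, ← map_mul, ← ofAdd_zsmul, ← ofAdd_zsmul, ← ofAdd_add]
  simp [baseHom, mul_comm]

/-- Points with first coordinate zero multiply by addition, so an integer combination is a product
of powers of the last four generators. With `base_mem_Delta`, this shows that `Delta` is large
enough for a bounded fundamental domain; `Delta_le` gave only the opposite inclusion. -/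
theorem fibre_mem_Delta {v : ℂ × ℂ} (hv : v ∈ fibreLattice) : (⟨0, v.1, v.2⟩ : H) ∈ Delta := by
  obtain ⟨a, b, c, d, h1, h2⟩ := hv
  have e2 : fibreHom (.ofAdd (-(m : ℂ), 1)) ∈ Delta := Subgroup.subset_closure ⟨2, rfl⟩
  have e3 : fibreHom (.ofAdd (1, (m : ℂ))) ∈ Delta := Subgroup.subset_closure ⟨3, rfl⟩
  have e4 : fibreHom (.ofAdd (-(2 * Real.pi * Complex.I * m), 2 * Real.pi * Complex.I)) ∈ Delta :=
    Subgroup.subset_closure ⟨4, rfl⟩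
  have e5 : fibreHom (.ofAdd (2 * Real.pi * Complex.I, 2 * Real.pi * Complex.I * m)) ∈ Delta :=
    Subgroup.subset_closure ⟨5, rfl⟩
  convert Delta.mul_mem (Delta.mul_mem (Delta.zpow_mem e2 a) (Delta.zpow_mem e3 b))
    (Delta.mul_mem (Delta.zpow_mem e4 c) (Delta.zpow_mem e5 d)) using 1
  rw [← map_zpow fibreHom, ← map_zpow fibreHom, ← map_zpow fibreHom, ← map_zpow fibreHom,
    ← map_mul fibreHom, ← map_mul fibreHom, ← map_mul fibreHom,
    ← ofAdd_zsmul, ← ofAdd_zsmul, ← ofAdd_zsmul, ← ofAdd_zsmul, ← ofAdd_add, ← ofAdd_add,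
    ← ofAdd_add]
  simp only [fibreHom, MonoidHom.coe_mk, OneHom.coe_mk, toAdd_ofAdd, Prod.smul_mk, Prod.mk_add_mk,
    zsmul_eq_mul, h1, h2, H.mk.injEq, true_and]
  constructor <;> ring

/-- Reduction of a real number modulo `c > 0`. -/
theorem exists_int_add_mem_Ico {c : ℝ} (hc : 0 < c) (y : ℝ) :
    ∃ k : ℤ, y + k * c ∈ Set.Ico 0 c := by
  have := (existsUnique_add_zsmul_mem_Ico hc y 0).exists
  simpa using this

/-- Real and imaginary parts are reduced modulo 1 and 2π, and 1 + 2π < 8. -/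
theorem exists_norm_add_le (z : ℂ) :
    ∃ a c : ℤ, ‖z + (a + 2 * Real.pi * Complex.I * c)‖ ≤ 8 := by
  obtain ⟨a, ha⟩ := exists_int_add_mem_Ico one_pos z.re
  obtain ⟨c, hc⟩ := exists_int_add_mem_Ico Real.two_pi_pos z.im
  refine ⟨a, c, (Complex.norm_le_abs_re_add_abs_im _).trans ?_⟩
  have h1 : (z + (a + 2 * Real.pi * Complex.I * c)).re = z.re + a * 1 := by simp
  have h2 : (z + (a + 2 * Real.pi * Complex.I * c)).im = z.im + c * (2 * Real.pi) := by
    simp [mul_comm]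
  rw [h1, h2, abs_of_nonneg ha.1, abs_of_nonneg hc.1]
  linarith [ha.2, hc.2, Real.pi_lt_d2]

theorem exists_fibreLattice_add_le (v : ℂ × ℂ) :
    ∃ w ∈ fibreLattice, ‖v.1 + w.1‖ ≤ 16 ∧ ‖v.2 + w.2‖ ≤ 16 := by
  -- These are the coordinates of `v` in the basis (-m, 1), (1, m), whose determinant is -(1 + m²).
  -- Reducing each to norm at most 8 and using m < 1 gives the bound 8 + 8 = 16.
  obtain ⟨A₀, B₀, h1, h2⟩ : ∃ A B : ℂ, v.1 = B - m * A ∧ v.2 = A + m * B := by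
    have hm : (1 + (m : ℂ) ^ 2) ≠ 0 := by
      rw [← Complex.ofReal_pow, ← Complex.ofReal_one, ← Complex.ofReal_add, Complex.ofReal_ne_zero]
      positivity
    exact ⟨(v.2 - m * v.1) / (1 + m ^ 2), (v.1 + m * v.2) / (1 + m ^ 2), by field_simp; ring,
      by field_simp; ring⟩
  obtain ⟨a, c, hA⟩ := exists_norm_add_le A₀
  obtain ⟨b, d, hB⟩ := exists_norm_add_le B₀
  set A := A₀ + (a + 2 * Real.pi * Complex.I * c) with hAd
  set B := B₀ + (b + 2 * Real.pi * Complex.I * d) with hBd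
  have hmn : ‖(m : ℂ)‖ ≤ 1 := by
    rw [Complex.norm_real, Real.norm_of_nonneg m_pos.le]; exact m_lt_one.le
  refine ⟨(-m * (a + 2 * Real.pi * Complex.I * c) + (b + 2 * Real.pi * Complex.I * d),
    (a + 2 * Real.pi * Complex.I * c) + m * (b + 2 * Real.pi * Complex.I * d)),
    ⟨a, b, c, d, rfl, rfl⟩, ?_, ?_⟩
  · have : v.1 + (-m * (a + 2 * Real.pi * Complex.I * c) + (b + 2 * Real.pi * Complex.I * d)) =
        B - m * A := by
      rw [h1, hAd, hBd]; ring
    rw [this]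
    refine (norm_sub_le _ _).trans ?_
    rw [norm_mul]
    nlinarith [norm_nonneg A]
  · have : v.2 + ((a + 2 * Real.pi * Complex.I * c) + m * (b + 2 * Real.pi * Complex.I * d)) =
        A + m * B := by
      rw [h2, hAd, hBd]; ring
    rw [this]
    refine (norm_add_le _ _).trans ?_
    rw [norm_mul]
    nlinarith [norm_nonneg B]

theorem exists_toX_eq (x : X) : ∃ w : ℂ × ℂ × ℂ, toX w = x ∧ w.1.re ∈ Set.Ico 0 ell ∧
    |w.1.im| ≤ 7 ∧ ‖w.2.1‖ ≤ 16 ∧ ‖w.2.2‖ ≤ 16 := by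
  obtain ⟨w, rfl⟩ := hasSmoothSections_toX.surjective x
  obtain ⟨k, hk⟩ := exists_int_add_mem_Ico (by linarith [half_lt_ell] : 0 < ell) w.1.re
  obtain ⟨j, hj⟩ := exists_int_add_mem_Ico Real.two_pi_pos w.1.im
  set z : ℂ := k * ell + 2 * Real.pi * Complex.I * j with hz
  -- The first coordinate is reduced before the fibre: translation by an element with zero first
  -- coordinate then only adds to w² and w³ and leaves w¹ untouched.
  obtain ⟨v, hv, h1, h2⟩ := exists_fibreLattice_add_le
    (Complex.exp (-z) * w.2.1, Complex.exp z * w.2.2)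
  have e1 := toX_mul_of_mem w (base_mem_Delta k j)
  have e2 := toX_mul_of_mem (w.1 + z, Complex.exp (-z) * w.2.1, Complex.exp z * w.2.2)
    (fibre_mem_Delta hv)
  simp only [neg_zero, Complex.exp_zero, one_mul, add_zero, ← hz] at e1 e2
  have hre : (w.1 + z).re = w.1.re + k * ell := by simp [hz]
  have him : (w.1 + z).im = w.1.im + j * (2 * Real.pi) := by simp [hz, mul_comm]
  refine ⟨_, e2.trans e1, by rwa [hre], ?_, h1, h2⟩
  rw [him, abs_of_nonneg hj.1]
  linarith [hj.2, Real.pi_lt_d2]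

/-- Every point of `N` is the image of a bounded vector, decomposed into the part along `sec` and
the part along the fibre of `proj`. -/
theorem exists_toN_eq (x : N) : ∃ (s : ℝ) (v : (ℂ × ℂ × ℂ) × ℝ), toN (secLift s + v) = x ∧
    s ∈ Set.Ico 0 ell ∧ v.1.1.re = 0 ∧ |v.1.1.im| ≤ 7 ∧ ‖v.1.2.1‖ ≤ 16 ∧ ‖v.1.2.2‖ ≤ 16 ∧
    |v.2| ≤ 7 := by
  obtain ⟨w, hw, h1, h2, h3, h4⟩ := exists_toX_eq x.1
  obtain ⟨t, ht⟩ := (hasSmoothSections_coe_circle (2 * Real.pi)).surjective x.2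
  obtain ⟨k, hk⟩ := exists_int_add_mem_Ico Real.two_pi_pos t
  refine ⟨w.1.re, ((w.1.im * Complex.I, w.2.1, w.2.2), t + k * (2 * Real.pi)), ?_, h1, by simp,
    by simpa using h2, h3, h4, ?_⟩
  · refine Prod.ext ?_ ?_
    · rw [← hw]
      refine congrArg toX (Prod.ext ?_ (Prod.ext ?_ ?_)) <;> simp [secLift, Complex.re_add_im]
    · rw [← ht]
      change (((0 : ℝ) + (t + k * (2 * Real.pi)) : ℝ) : AddCircle (2 * Real.pi)) = _
      rw [zero_add, AddCircle.coe_add, ← zsmul_eq_mul, AddCircle.coe_zsmul, AddCircle.coe_period,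
        smul_zero, add_zero]
  · rw [abs_of_nonneg hk.1]
    linarith [hk.2, Real.pi_lt_d2]

theorem compactSpace_N : CompactSpace N := by
  have hK : IsCompact (Metric.closedBall (0 : (ℂ × ℂ × ℂ) × ℝ) (ell + 16)) :=
    isCompact_closedBall _ _
  have := hK.image hasSmoothSections_toN.contMDiff.continuous
  refine ⟨this.of_isClosed_subset isClosed_univ fun x _ => ?_⟩
  obtain ⟨s, v, rfl, hs, h1, h2, h3, h4, h5⟩ := exists_toN_eq x
  refine ⟨_, ?_, rfl⟩
  rw [mem_closedBall_zero_iff]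
  have h6 : ‖v.1.1‖ ≤ 16 := (Complex.norm_le_abs_re_add_abs_im _).trans (by
    rw [h1, abs_zero]; linarith)
  have h7 : ‖v‖ ≤ 16 := norm_prod_le_iff.mpr
    ⟨norm_prod_le_iff.mpr ⟨h6, norm_prod_le_iff.mpr ⟨h3, h4⟩⟩, h5.trans (by norm_num)⟩
  have h8 : ‖secLift s‖ ≤ ell := by
    have : 0 ≤ ell := by linarith [half_lt_ell]
    simpa [secLift, Prod.norm_def, abs_of_nonneg hs.1, this] using hs.2.le
  exact (norm_add_le _ _).trans (add_le_add h8 h7)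

/-! ### The pointwise G₂ normal form. -/

section LinearAlgebra

variable {V : Type*} [AddCommGroup V] [Module ℝ V] {A : Type*} [CommRing A] [Algebra ℝ A]

theorem wedge₂_apply (a b : V →ₗ[ℝ] A) (x y : V) :
    wedge₂ a b ![x, y] = a x * b y - a y * b x := by
  simp [wedge₂, wedge, AlternatingMap.alternatizeUncurryFin_apply, Fin.sum_univ_succ,
    Fin.removeNth]
  ring

theorem wedge_apply₂ (a : V →ₗ[ℝ] A) (η : V [⋀^Fin 2]→ₗ[ℝ] A) (v : Fin 3 → V) :
    wedge a η v = a (v 0) * η ![v 1, v 2] - a (v 1) * η ![v 0, v 2] + a (v 2) * η ![v 0, v 1] := by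
  have h0 : (0 : Fin 3).removeNth v = ![v 1, v 2] := by
    ext i; fin_cases i <;> rfl
  have h1 : (1 : Fin 3).removeNth v = ![v 0, v 2] := by
    ext i; fin_cases i <;> rfl
  have h2 : (2 : Fin 3).removeNth v = ![v 0, v 1] := by
    ext i; fin_cases i <;> rfl
  rw [wedge, AlternatingMap.alternatizeUncurryFin_apply, Fin.sum_univ_three]
  erw [h0, h1, h2]
  simp
  ring

/-- The linear forms `(A Re z¹, -B Im z¹, -C t, s Re(p z²), s Im(p z²), s Re z³, s Im z³)` on
`ℂ³ × ℝ`. -/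
def coframe (A B C s : ℝ) (p : ℂ) : Fin 7 → (ℂ × ℂ × ℂ) × ℝ →L[ℝ] ℝ :=
  letI z (i : Fin 3) : (ℂ × ℂ × ℂ) × ℝ →L[ℝ] ℂ := (dw i).comp (.fst ℝ _ ℝ)
  ![A • Complex.reCLM.comp (z 0), -(B • Complex.imCLM.comp (z 0)), -(C • .snd ℝ _ ℝ),
    s • Complex.reCLM.comp (p • z 1), s • Complex.imCLM.comp (p • z 1),
    s • Complex.reCLM.comp (z 2), s • Complex.imCLM.comp (z 2)]

theorem coframe_apply (A B C s : ℝ) (p : ℂ) (i : Fin 7) (u : (ℂ × ℂ × ℂ) × ℝ) :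
    coframe A B C s p i u = ![A * u.1.1.re, -(B * u.1.1.im), -(C * u.2), s * (p * u.1.2.1).re,
      s * (p * u.1.2.1).im, s * u.1.2.2.re, s * u.1.2.2.im] i := by
  fin_cases i <;> simp [coframe, dw]

/-- The 3-form `φ` is `G₂`-standard in a suitably rescaled coframe. -/
theorem standardG2_coframe {A B C s κ α β ν R : ℝ} {p : ℂ} (hp : Complex.normSq p = 1)
    (h1 : A * B * C = κ * (α * β)) (h2 : A * s ^ 2 = κ * (α * ν)) (h3 : B * s ^ 2 = κ * β * R)
    (h4 : C * s ^ 2 = κ * R) {T₁ T₂ T₃ : V →ₗ[ℝ] ℂ} {g₃ : V →ₗ[ℝ] ℝ} {θ : Fin 7 → Module.Dual ℝ V}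
    (hθ : ∀ i u, θ i u = coframe A B C s p i ((T₁ u, T₂ u, T₃ u), g₃ u)) :
    κ • ((α * β) • wedge₃ (Complex.reLm ∘ₗ T₁) (Complex.imLm ∘ₗ T₁) g₃
      + (α * ν) • wedge (Complex.reLm ∘ₗ T₁) (Complex.reLm.compAlternatingMap
          ((Complex.I / 2) • (wedge₂ T₂ (Complex.conjLIE.toLinearEquiv.toLinearMap ∘ₗ T₂) +
            wedge₂ T₃ (Complex.conjLIE.toLinearEquiv.toLinearMap ∘ₗ T₃))))
      - β • wedge (Complex.imLm ∘ₗ T₁)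
          (Complex.reLm.compAlternatingMap (((R : ℂ) * p) • wedge₂ T₂ T₃))
      + wedge g₃ (Complex.imLm.compAlternatingMap (((R : ℂ) * p) • wedge₂ T₂ T₃))) =
    standardG2 θ := by
  have hp' : p.re * p.re + p.im * p.im = 1 := hp
  ext v
  -- `W a b` is a ∧ b evaluated on two vectors, and `c a η` below is a ∧ η evaluated on the triple
  -- `v`. In this notation ω, Re(λΩ) and Im(λΩ) become combinations of products of real coordinates.
  let W (a b : V → ℝ) (x y : V) : ℝ := a x * b y - a y * b x
  let c (a : V → ℝ) (η : V → V → ℝ) : ℝ :=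
    a (v 0) * η (v 1) (v 2) - a (v 1) * η (v 0) (v 2) + a (v 2) * η (v 0) (v 1)
  let x₁ (u : V) := (T₁ u).re
  let y₁ (u : V) := (T₁ u).im
  let x₂ (u : V) := (T₂ u).re
  let y₂ (u : V) := (T₂ u).im
  let x₃ (u : V) := (T₃ u).re
  let y₃ (u : V) := (T₃ u).im
  have hω (x y : V) : (Complex.I / 2 * (T₂ x * (starRingEnd ℂ) (T₂ y)
      - T₂ y * (starRingEnd ℂ) (T₂ x) + (T₃ x * (starRingEnd ℂ) (T₃ y)
      - T₃ y * (starRingEnd ℂ) (T₃ x)))).re = W x₂ y₂ x y + W x₃ y₃ x y := by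
    simp [W, x₂, y₂, x₃, y₃]
    ring
  have hre (x y : V) : ((R : ℂ) * p * (T₂ x * T₃ y - T₂ y * T₃ x)).re =
      R * (p.re * (W x₂ x₃ x y - W y₂ y₃ x y) - p.im * (W x₂ y₃ x y + W y₂ x₃ x y)) := by
    simp [W, x₂, y₂, x₃, y₃]
    ring
  have him (x y : V) : ((R : ℂ) * p * (T₂ x * T₃ y - T₂ y * T₃ x)).im =
      R * (p.re * (W x₂ y₃ x y + W y₂ x₃ x y) + p.im * (W x₂ x₃ x y - W y₂ y₃ x y)) := by
    simp [W, x₂, y₂, x₃, y₃]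
    ring
  simp only [standardG2, wedge₃, AlternatingMap.smul_apply, AlternatingMap.add_apply,
    AlternatingMap.sub_apply, wedge_apply₂, wedge₂_apply, LinearMap.compAlternatingMap_apply,
    smul_eq_mul, LinearMap.comp_apply, hθ, coframe_apply, Complex.reLm_coe, Complex.imLm_coe,
    LinearEquiv.coe_coe, LinearIsometryEquiv.coe_toLinearEquiv, Complex.conjLIE_apply, hω, hre, him]
  simp only [Matrix.cons_val, Complex.mul_re, Complex.mul_im]
  -- Each of `h1`, …, `h4` matches one summand of φ. The last term is needed because the rotated
  -- covectors produce |p|² x₂ ∧ y₂, where ω has x₂ ∧ y₂.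
  linear_combination -c x₁ (W y₁ g₃) * h1 - c x₁ (fun x y => W x₂ y₂ x y + W x₃ y₃ x y) * h2
    + c y₁ (fun x y => p.re * (W x₂ x₃ x y - W y₂ y₃ x y) - p.im * (W x₂ y₃ x y + W y₂ x₃ x y)) * h3
    - c g₃ (fun x y => p.re * (W x₂ y₃ x y + W y₂ x₃ x y) + p.im * (W x₂ x₃ x y - W y₂ y₃ x y)) * h4
    - A * s ^ 2 * c x₁ (W x₂ y₂) * hp'

end LinearAlgebra

/-- By dimension, `n` forms without common zero are the coordinates of an isomorphism with ℝⁿ, hence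
the dual basis of the corresponding basis of `V`. -/
theorem exists_basis_dual {V : Type*} [AddCommGroup V] [Module ℝ V] [FiniteDimensional ℝ V]
    {n : ℕ} (hn : Module.finrank ℝ V = n) (θ : Fin n → Module.Dual ℝ V)
    (hθ : ∀ v, (∀ i, θ i v = 0) → v = 0) :
    ∃ b : Module.Basis (Fin n) ℝ (Module.Dual ℝ V), ⇑b = θ := by
  have hinj : Function.Injective (LinearMap.pi θ) := by
    rw [injective_iff_map_eq_zero]
    exact fun v hv => hθ v fun i => congrFun hv i
  let e := LinearMap.linearEquivOfInjective (LinearMap.pi θ) hinj (by simp [hn])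
  refine ⟨(Module.Basis.ofEquivFun e).dualBasis, funext fun i => LinearMap.ext fun v => ?_⟩
  rw [Module.Basis.dualBasis_apply, Module.Basis.ofEquivFun_repr_apply]
  rfl

/-- To prove a property of the tangent vectors of `N`, it suffices to consider the images of the
vectors of `ℂ³ × ℝ`. -/
theorem tangent_induction_N {Q : ∀ x : N, TangentSpace IN x → Prop}
    (h : ∀ a u : (ℂ × ℂ × ℂ) × ℝ, Q (toN a) (mfderiv 𝓘(ℝ, (ℂ × ℂ × ℂ) × ℝ) IN toN a u)) (x : N)
    (v : TangentSpace IN x) : Q x v := by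
  obtain ⟨a, rfl⟩ := hasSmoothSections_toN.surjective x
  obtain ⟨u, rfl⟩ := hasSmoothSections_toN.surjective_mfderiv a v
  exact h a u

/-- To prove a property of the tangent vectors of a circle, it suffices to consider the images of
the vectors of `ℝ`. -/
theorem tangent_induction_circle {T : ℝ} {Q : ∀ x : AddCircle T, TangentSpace 𝓘(ℝ, ℝ) x → Prop}
    (h : ∀ a u : ℝ, Q (a : AddCircle T)
      (mfderiv 𝓘(ℝ, ℝ) 𝓘(ℝ, ℝ) ((↑) : ℝ → AddCircle T) a u)) (x : AddCircle T)
    (v : TangentSpace 𝓘(ℝ, ℝ) x) : Q x v := by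
  obtain ⟨a, rfl⟩ := (hasSmoothSections_coe_circle T).surjective x
  obtain ⟨u, rfl⟩ := (hasSmoothSections_coe_circle T).surjective_mfderiv a v
  exact h a u

/-- The forms `(Θ¹, Θ², Θ³, g³)` on `N`. -/
def coordForm (x : N) : TangentSpace IN x →L[ℝ] (ℂ × ℂ × ℂ) × ℝ :=
  letI T (i : Fin 3) : TangentSpace IN x →L[ℝ] ℂ :=
    (ThetaX i x.1).comp (mfderiv IN 𝓘(ℝ, ℂ × ℂ × ℂ) Prod.fst x)
  ((T 0).prod ((T 1).prod (T 2))).prod ((dt _ x.2).comp (mfderiv IN 𝓘(ℝ, ℝ) Prod.snd x))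

theorem coordForm_apply (x : N) (u : TangentSpace IN x) :
    coordForm x u = ((Theta 0 x u, Theta 1 x u, Theta 2 x u), g3 x u) := rfl

/-- The forms `(Θ¹, Θ², Θ³, dt)` on `ℂ³ × ℝ`. -/
def coordLift (a : (ℂ × ℂ × ℂ) × ℝ) : (ℂ × ℂ × ℂ) × ℝ →L[ℝ] (ℂ × ℂ × ℂ) × ℝ :=
  (((ThetaH 0 a.1).prod ((ThetaH 1 a.1).prod (ThetaH 2 a.1))).comp (.fst ℝ _ ℝ)).prod
    (.snd ℝ _ ℝ)

theorem coordLift_apply (a u : (ℂ × ℂ × ℂ) × ℝ) :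
    coordLift a u = ((u.1.1, Complex.exp a.1.1 * u.1.2.1, Complex.exp (-a.1.1) * u.1.2.2), u.2) := by
  simp [coordLift, ThetaH, dw]

theorem _root_.ContDiff.clm_prod {D U V W : Type*} [NormedAddCommGroup D] [NormedSpace ℝ D]
    [NormedAddCommGroup U] [NormedSpace ℝ U] [NormedAddCommGroup V] [NormedSpace ℝ V]
    [NormedAddCommGroup W] [NormedSpace ℝ W] {n : WithTop ℕ∞} {f : D → U →L[ℝ] V}
    {g : D → U →L[ℝ] W} (hf : ContDiff ℝ n f) (hg : ContDiff ℝ n g) :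
    ContDiff ℝ n fun a => (f a).prod (g a) :=
  (ContinuousLinearMap.prodₗᵢ ℝ :
    (U →L[ℝ] V) × (U →L[ℝ] W) ≃ₗᵢ[ℝ] (U →L[ℝ] V × W)).contDiff.comp (hf.prodMk hg)

theorem contDiff_coordLift : ContDiff ℝ ∞ coordLift := by
  have hT (i : Fin 3) : ContDiff ℝ ∞ fun a : (ℂ × ℂ × ℂ) × ℝ => ThetaH i a.1 := by
    unfold ThetaH
    fin_cases i
    · exact (contDiff_const (c := (1 : ℂ) • dw 0))
    · exact ContDiff.smul (by fun_prop : ContDiff ℝ ∞ fun a : (ℂ × ℂ × ℂ) × ℝ => Complex.exp a.1.1)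
        contDiff_const
    · exact ContDiff.smul
        (by fun_prop : ContDiff ℝ ∞ fun a : (ℂ × ℂ × ℂ) × ℝ => Complex.exp (-a.1.1)) contDiff_const
  exact (((hT 0).clm_prod ((hT 1).clm_prod (hT 2))).clm_comp
    (contDiff_const (c := ContinuousLinearMap.fst ℝ (ℂ × ℂ × ℂ) ℝ))).clm_prod
    (contDiff_const (c := ContinuousLinearMap.snd ℝ (ℂ × ℂ × ℂ) ℝ))

theorem coordForm_apply_mfderiv (a u : (ℂ × ℂ × ℂ) × ℝ) :
    coordForm (toN a) (mfderiv 𝓘(ℝ, (ℂ × ℂ × ℂ) × ℝ) IN toN a u) = coordLift a u := by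
  rw [coordForm_apply, Theta_apply_mfderiv, Theta_apply_mfderiv, Theta_apply_mfderiv,
    g3_apply_mfderiv]
  rfl

theorem coordForm_injective (x : N) (v : TangentSpace IN x) : coordForm x v = 0 → v = 0 := by
  refine tangent_induction_N (Q := fun x v => coordForm x v = 0 → v = 0) (fun a u h => ?_) x v
  rw [coordForm_apply_mfderiv, coordLift_apply] at h
  simp only [Prod.mk_eq_zero, mul_eq_zero, Complex.exp_ne_zero, false_or] at h
  have : u = 0 := Prod.ext (Prod.ext h.1.1 (Prod.ext h.1.2.1 h.1.2.2)) h.2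
  rw [this]
  exact map_zero _

theorem coframe_injective {A B C s : ℝ} {p : ℂ} (hA : A ≠ 0) (hB : B ≠ 0) (hC : C ≠ 0)
    (hs : s ≠ 0) (hp : p ≠ 0) (u : (ℂ × ℂ × ℂ) × ℝ) (h : ∀ i, coframe A B C s p i u = 0) :
    u = 0 := by
  simp only [coframe_apply] at h
  have h0 := h 0
  have h1 := h 1
  have h2 := h 2
  have h3 := h 3
  have h4 := h 4
  have h5 := h 5
  have h6 := h 6
  simp only [Matrix.cons_val, neg_eq_zero, mul_eq_zero, hA, hB, hC, hs, false_or]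
    at h0 h1 h2 h3 h4 h5 h6
  have h7 : p * u.1.2.1 = 0 := Complex.ext h3 h4
  exact Prod.ext (Prod.ext (Complex.ext h0 h1) (Prod.ext ((mul_eq_zero.mp h7).resolve_left hp)
    (Complex.ext h5 h6))) h2

/-- The unit phase `p` only rotates the second complex coordinate, so the metric does not see it. -/
theorem sum_coframe_mul_self {A B C s : ℝ} {p : ℂ} (hp : Complex.normSq p = 1)
    (u : (ℂ × ℂ × ℂ) × ℝ) :
    ∑ i, coframe A B C s p i u * coframe A B C s p i u =
      A ^ 2 * u.1.1.re ^ 2 + (B ^ 2 * u.1.1.im ^ 2 + C ^ 2 * u.2 ^ 2 +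
        s ^ 2 * (‖u.1.2.1‖ ^ 2 + ‖u.1.2.2‖ ^ 2)) := by
  have h1 : ‖u.1.2.1‖ ^ 2 = ‖p * u.1.2.1‖ ^ 2 := by
    rw [norm_mul, mul_pow, ← Complex.normSq_eq_norm_sq p, hp, one_mul]
  rw [h1, ← Complex.normSq_eq_norm_sq, ← Complex.normSq_eq_norm_sq, Complex.normSq_apply,
    Complex.normSq_apply]
  simp only [coframe_apply, Fin.sum_univ_succ, Matrix.cons_val_zero, Matrix.cons_val_succ,
    Finset.univ_eq_empty, Finset.sum_empty]
  ring

/-! ### The metrics on the total space and on the base. -/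

section Metrics

variable {α β : ℝ} (hα : α ≠ 0) (hβ : β ≠ 0) {lam : ℂ} (hlam : lam ≠ 0)

/-- `(λ λ̄)^{1/6}`. -/
def rad (lam : ℂ) : ℝ := ‖lam‖ ^ (1 / 3 : ℝ)

include hlam in
theorem rad_pos : 0 < rad lam := Real.rpow_pos_of_pos (norm_pos_iff.mpr hlam) _

theorem rad_pow_three (lam : ℂ) : rad lam ^ 3 = ‖lam‖ := by
  rw [rad, ← Real.rpow_natCast, ← Real.rpow_mul (norm_nonneg _)]
  norm_num

include hlam in
theorem normSq_phase : Complex.normSq (lam / ‖lam‖) = 1 := by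
  rw [Complex.normSq_eq_norm_sq, norm_div, Complex.norm_real, norm_norm,
    div_self (norm_ne_zero_iff.mpr hlam), one_pow]

include hlam in
theorem phase_ne_zero : lam / ‖lam‖ ≠ 0 :=
  div_ne_zero hlam (Complex.ofReal_ne_zero.mpr (norm_ne_zero_iff.mpr hlam))

/-- The 1-forms on `ℂ³ × ℝ` defining the metric of `μ⁻¹² φ(α, β, λ; μ)`. -/
def frame (α β : ℝ) (lam : ℂ) (μ : ℝ) : Fin 7 → (ℂ × ℂ × ℂ) × ℝ →L[ℝ] ℝ :=
  coframe (α / rad lam ^ 2) (β * rad lam / μ ^ 6) (rad lam / μ ^ 6) (rad lam / μ ^ 3) (lam / ‖lam‖)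

include hα hβ hlam in
theorem frame_injective {μ : ℝ} (hμ : 1 ≤ μ) (u : (ℂ × ℂ × ℂ) × ℝ)
    (h : ∀ i, frame α β lam μ i u = 0) : u = 0 := by
  have hr := (rad_pos hlam).ne'
  have hμ0 : μ ≠ 0 := by positivity
  exact coframe_injective (by positivity) (by positivity) (by positivity) (by positivity)
    (phase_ne_zero hlam) u h

/-- The metric of `μ⁻¹² φ(α, β, λ; μ)` on `N`. -/
def metricN (μ : Set.Ici (1 : ℝ)) :
    ContMDiffRiemannianMetric IN ∞ ((ℂ × ℂ × ℂ) × ℝ) (fun x : N => TangentSpace IN x) :=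
  metricOfForms hasSmoothSections_toN (fun i x => (frame α β lam μ i).comp (coordForm x))
    (η := fun i a => (frame α β lam μ i).comp (coordLift a))
    (fun _ => contDiff_const.clm_comp contDiff_coordLift)
    (fun i a u => congrArg (frame α β lam μ i) (coordForm_apply_mfderiv a u))
    (fun x v h => coordForm_injective x v (frame_injective hα hβ hlam μ.2 _ h))

theorem metricN_inner (μ : Set.Ici (1 : ℝ)) (x : N) (u v : TangentSpace IN x) :
    (metricN hα hβ hlam μ).inner x u v =
      ∑ i, frame α β lam μ i (coordForm x u) * frame α β lam μ i (coordForm x v) :=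
  metricOfForms_inner ..

theorem metricN_inner_self (μ : Set.Ici (1 : ℝ)) (x : N) (u : TangentSpace IN x) :
    (metricN hα hβ hlam μ).inner x u u =
      (α / rad lam ^ 2) ^ 2 * (coordForm x u).1.1.re ^ 2 +
        ((β * rad lam / μ ^ 6) ^ 2 * (coordForm x u).1.1.im ^ 2 +
          (rad lam / μ ^ 6) ^ 2 * (coordForm x u).2 ^ 2 +
          (rad lam / μ ^ 3) ^ 2 *
            (‖(coordForm x u).1.2.1‖ ^ 2 + ‖(coordForm x u).1.2.2‖ ^ 2)) := by
  rw [metricN_inner]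
  exact sum_coframe_mul_self (normSq_phase hlam) _

theorem isG2Metric_metricN (μ : Set.Ici (1 : ℝ)) (x : N) :
    IsG2Metric (((μ : ℝ) ^ 12)⁻¹ • phi α β lam μ x)
      (fun u v => (metricN hα hβ hlam μ).inner x u v) := by
  have hμ : (1 : ℝ) ≤ μ := μ.2
  have hμ0 : (μ : ℝ) ≠ 0 := by positivity
  have hr := (rad_pos hlam).ne'
  have : FiniteDimensional ℝ (TangentSpace IN x) :=
    inferInstanceAs (FiniteDimensional ℝ ((ℂ × ℂ × ℂ) × ℝ))
  have hdim : Module.finrank ℝ (TangentSpace IN x) = 7 := by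
    change Module.finrank ℝ ((ℂ × ℂ × ℂ) × ℝ) = 7
    simp [Module.finrank_prod, Complex.finrank_real_complex]
  obtain ⟨b, hb⟩ := exists_basis_dual hdim
    (fun i => ((frame α β lam μ i).comp (coordForm x)).toLinearMap)
    (fun v h => coordForm_injective x v (frame_injective hα hβ hlam hμ _ h))
  refine ⟨b, ?_, fun u v => ?_⟩
  · have hl : ((‖lam‖ : ℝ) : ℂ) * (lam / ‖lam‖) = lam :=
      mul_div_cancel₀ _ (Complex.ofReal_ne_zero.mpr (norm_ne_zero_iff.mpr hlam))
    have key := standardG2_coframe (V := TangentSpace IN x) (κ := ((μ : ℝ) ^ 12)⁻¹) (α := α)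
      (β := β) (ν := (μ : ℝ) ^ 6) (R := ‖lam‖) (normSq_phase hlam)
      -- The four relations force these values up to the sign of s: they give B = βC and s² = μ⁶C²,
      -- then C³ = |λ|/μ¹⁸, and finally A = α/r² with r = |λ|^(1/3).
      (A := α / rad lam ^ 2) (B := β * rad lam / μ ^ 6) (C := rad lam / μ ^ 6)
      (s := rad lam / μ ^ 3) (T₁ := Theta 0 x) (T₂ := Theta 1 x) (T₃ := Theta 2 x) (g₃ := g3 x)
      (θ := b) (by field_simp) (by field_simp) (by rw [← rad_pow_three]; field_simp)
      (by rw [← rad_pow_three]; field_simp) (fun i u => by rw [hb]; rfl)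
    rw [hl] at key
    exact key
  · rw [hb]
    exact metricN_inner ..

/-- The metric `α² (λ λ̄)^{-2/3} g_E` on `ℝ / ℓℤ`. -/
def metricB : ContMDiffRiemannianMetric 𝓘(ℝ, ℝ) ∞ ℝ
    (fun t : AddCircle ell => TangentSpace 𝓘(ℝ, ℝ) t) :=
  metricOfForms (hasSmoothSections_coe_circle ell)
    (fun (_ : Unit) t => (α / rad lam ^ 2) • dt ell t)
    (η := fun _ _ => (α / rad lam ^ 2) • ContinuousLinearMap.id ℝ ℝ)
    (fun _ => contDiff_const)
    (fun _ a u => congrArg (fun y : ℝ => (α / rad lam ^ 2) * y) (dt_apply_mfderiv ell a u))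
    (fun t v h => by
      refine tangent_induction_circle
        (Q := fun t v => (α / rad lam ^ 2) * dt ell t v = 0 → v = 0) (fun a u h => ?_) t v (h ())
      have hr := (rad_pos hlam).ne'
      rw [dt_apply_mfderiv] at h
      have h2 : u = 0 := (mul_eq_zero.mp h).resolve_left (by positivity)
      rw [h2]
      exact map_zero _)

theorem metricB_inner (t : AddCircle ell) (a b : TangentSpace 𝓘(ℝ, ℝ) t) :
    (metricB hα hlam).inner t a b = (α / rad lam ^ 2) ^ 2 * (dt ell t a * dt ell t b) := by
  refine (metricOfForms_inner ..).trans ?_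
  simp
  ring

theorem sq_div_rad : (α / rad lam ^ 2) ^ 2 = α ^ 2 * (Complex.normSq lam) ^ (-(2 / 3) : ℝ) := by
  have h0 := norm_nonneg lam
  rw [rad, div_pow, div_eq_mul_inv, Complex.normSq_eq_norm_sq, ← Real.rpow_natCast (_ ^ _) 2,
    ← Real.rpow_natCast (_ ^ _) 2, ← Real.rpow_natCast ‖lam‖ 2, ← Real.rpow_mul h0,
    ← Real.rpow_mul h0, ← Real.rpow_mul h0, ← Real.rpow_neg h0]
  norm_num

/-- The pull-back of dt under `proj` is Re Θ¹, so the base metric pulls back exactly to the square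
of the first covector. -/
theorem dt_mfderiv_proj (x : N) (u : TangentSpace IN x) :
    dt ell (proj x) (mfderiv IN 𝓘(ℝ, ℝ) proj x u) = (coordForm x u).1.1.re := by
  refine tangent_induction_N (Q := fun x u =>
    dt ell (proj x) (mfderiv IN 𝓘(ℝ, ℝ) proj x u) = (coordForm x u).1.1.re) (fun a u => ?_) x u
  rw [coordForm_apply_mfderiv, coordLift_apply, mfderiv_proj_mfderiv_toN]
  exact dt_apply_mfderiv ell _ _

end Metrics

/-! ### Comparison of the distances -/

section Comparison

variable {α β : ℝ} (hα : α ≠ 0) (hβ : β ≠ 0) {lam : ℂ} (hlam : lam ≠ 0)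

theorem metricN_sub_metricB (μ : Set.Ici (1 : ℝ)) (x : N) (u : TangentSpace IN x) :
    (metricN hα hβ hlam μ).inner x u u - (metricB hα hlam).inner (proj x)
        (mfderiv IN 𝓘(ℝ, ℝ) proj x u) (mfderiv IN 𝓘(ℝ, ℝ) proj x u) =
      (β * rad lam / μ ^ 6) ^ 2 * (coordForm x u).1.1.im ^ 2 +
        (rad lam / μ ^ 6) ^ 2 * (coordForm x u).2 ^ 2 +
        (rad lam / μ ^ 3) ^ 2 *
          (‖(coordForm x u).1.2.1‖ ^ 2 + ‖(coordForm x u).1.2.2‖ ^ 2) := by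
  rw [metricN_inner_self, metricB_inner, dt_mfderiv_proj]
  ring

theorem metricN_sub_metricB_nonneg (μ : Set.Ici (1 : ℝ)) (x : N) (u : TangentSpace IN x) :
    0 ≤ (metricN hα hβ hlam μ).inner x u u - (metricB hα hlam).inner (proj x)
        (mfderiv IN 𝓘(ℝ, ℝ) proj x u) (mfderiv IN 𝓘(ℝ, ℝ) proj x u) := by
  rw [metricN_sub_metricB]
  positivity

/-- The vertical part of the metric is `O(μ⁻⁶)`. -/
theorem vertical_le (b r y t z : ℝ) {μ : ℝ} (hμ : 1 ≤ μ) :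
    (b * r / μ ^ 6) ^ 2 * y ^ 2 + (r / μ ^ 6) ^ 2 * t ^ 2 + (r / μ ^ 3) ^ 2 * z ≤
      ((b * r) ^ 2 * y ^ 2 + r ^ 2 * t ^ 2 + r ^ 2 * z) / μ ^ 6 := by
  have hμ0 : 0 < μ := by linarith
  have h : (μ ^ 12)⁻¹ ≤ (μ ^ 6)⁻¹ := inv_anti₀ (by positivity) (pow_le_pow_right₀ hμ (by norm_num))
  have e : ((b * r) ^ 2 * y ^ 2 + r ^ 2 * t ^ 2 + r ^ 2 * z) / μ ^ 6 =
      ((b * r) ^ 2 * y ^ 2 + r ^ 2 * t ^ 2) * (μ ^ 6)⁻¹ + r ^ 2 * z * (μ ^ 6)⁻¹ := by ring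
  have e' : (b * r / μ ^ 6) ^ 2 * y ^ 2 + (r / μ ^ 6) ^ 2 * t ^ 2 + (r / μ ^ 3) ^ 2 * z =
      ((b * r) ^ 2 * y ^ 2 + r ^ 2 * t ^ 2) * (μ ^ 12)⁻¹ + r ^ 2 * z * (μ ^ 6)⁻¹ := by
    field_simp
  rw [e, e']
  gcongr

theorem metricN_sub_metricB_le (μ : Set.Ici (1 : ℝ)) (x : N) (u : TangentSpace IN x) :
    (metricN hα hβ hlam μ).inner x u u - (metricB hα hlam).inner (proj x)
        (mfderiv IN 𝓘(ℝ, ℝ) proj x u) (mfderiv IN 𝓘(ℝ, ℝ) proj x u) ≤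
      ((μ : ℝ) ^ 6)⁻¹ * (metricN hα hβ hlam ⟨1, Set.mem_Ici.mpr le_rfl⟩).inner x u u := by
  rw [metricN_sub_metricB, metricN_inner_self]
  refine (vertical_le _ _ _ _ _ μ.2).trans ?_
  rw [div_eq_inv_mul]
  have hμ : (0 : ℝ) < μ := lt_of_lt_of_le one_pos μ.2
  refine mul_le_mul_of_nonneg_left ?_ (by positivity)
  simp only [one_pow, div_one]
  -- At μ = 1 the metric is the unscaled vertical part plus this nonnegative horizontal square.
  nlinarith [mul_nonneg (sq_nonneg (α / rad lam ^ 2)) (sq_nonneg (coordForm x u).1.1.re)]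

theorem riemEDist_proj_le (μ : Set.Ici (1 : ℝ)) (x y : N) :
    riemEDist (metricB hα hlam) (proj x) (proj y) ≤ riemEDist (metricN hα hβ hlam μ) x y :=
  riemEDist_map_le _ _ (contMDiff_proj.of_le (by simp))
    (fun x u => sub_nonneg.mp (metricN_sub_metricB_nonneg hα hβ hlam μ x u)) x y

/-- Along the section Im Θ¹, Θ², Θ³ and dt vanish, so its speed is measured by the first covector
alone and equals the speed in the base. -/
theorem riemEDist_sec_le (μ : Set.Ici (1 : ℝ)) (s t : AddCircle ell) :
    riemEDist (metricN hα hβ hlam μ) (sec s) (sec t) ≤ riemEDist (metricB hα hlam) s t := by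
  refine riemEDist_map_le _ _ (contMDiff_sec.of_le (by simp)) (fun x u => ?_) s t
  refine tangent_induction_circle (Q := fun x u =>
    (metricN hα hβ hlam μ).inner (sec x) (mfderiv 𝓘(ℝ, ℝ) IN sec x u)
      (mfderiv 𝓘(ℝ, ℝ) IN sec x u) ≤ (metricB hα hlam).inner x u u) (fun a u => ?_) x u
  rw [mfderiv_sec_mfderiv_coe, metricB_inner, dt_apply_mfderiv]
  have h := metricN_inner_self hα hβ hlam μ (toN (secLift a))
    (mfderiv 𝓘(ℝ, (ℂ × ℂ × ℂ) × ℝ) IN toN (secLift a) (secLift u))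
  rw [coordForm_apply_mfderiv, coordLift_apply] at h
  refine h.le.trans (le_of_eq ?_)
  simp [secLift, pow_two]

theorem riemEDist_metricB_ne_top (s t : AddCircle ell) : riemEDist (metricB hα hlam) s t ≠ ⊤ := by
  obtain ⟨a, rfl⟩ := (hasSmoothSections_coe_circle ell).surjective s
  obtain ⟨b, rfl⟩ := (hasSmoothSections_coe_circle ell).surjective t
  have h := riemEDist_image_segment_le (metricB hα hlam) (hasSmoothSections_coe_circle ell).contMDiff
    a (b - a) (K := |α / rad lam ^ 2 * (b - a)|) (abs_nonneg _) (fun t _ => by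
      rw [metricB_inner, dt_apply_mfderiv, sq_abs]
      exact le_of_eq (by ring))
  rw [add_sub_cancel] at h
  exact (h.trans_lt ENNReal.ofReal_lt_top).ne

/-- The constant in the estimate of the diameters of the fibres. -/
def fibreConst (β : ℝ) (lam : ℂ) : ℝ :=
  √((β * rad lam) ^ 2 * 7 ^ 2 + rad lam ^ 2 * 7 ^ 2 + rad lam ^ 2 * (2 * (Real.exp ell * 16) ^ 2))

theorem fibreConst_nonneg (β : ℝ) (lam : ℂ) : 0 ≤ fibreConst β lam := Real.sqrt_nonneg _

theorem riemEDist_sec_proj_le (μ : Set.Ici (1 : ℝ)) (x : N) :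
    riemEDist (metricN hα hβ hlam μ) (sec (proj x)) x ≤
      ENNReal.ofReal (fibreConst β lam / (μ : ℝ) ^ 3) := by
  have hμ : (1 : ℝ) ≤ μ := μ.2
  obtain ⟨s, v, rfl, hs, h1, h2, h3, h4, h5⟩ := exists_toN_eq x
  have hsec : sec (proj (toN (secLift s + v))) = toN (secLift s) := by
    rw [proj_toN]
    have : (secLift s + v).1.1.re = s := by simp [secLift, h1]
    rw [this]
    rfl
  rw [hsec]
  -- The segment keeps Re w¹ = s fixed and is therefore vertical. Since s lies in [0, ℓ), the
  -- factors e^s and e^(-s) in Θ² and Θ³ are at most e^ℓ; with the coordinate bounds 7, 7, 16, 16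
  -- this gives `fibreConst`.
  refine riemEDist_image_segment_le _ hasSmoothSections_toN.contMDiff _ _
    (div_nonneg (fibreConst_nonneg β lam) (by positivity)) fun t ht => ?_
  have h := metricN_inner_self hα hβ hlam μ (toN (secLift s + t • v))
    (mfderiv 𝓘(ℝ, (ℂ × ℂ × ℂ) × ℝ) IN toN (secLift s + t • v) v)
  rw [coordForm_apply_mfderiv, coordLift_apply] at h
  refine h.le.trans ?_
  have hK : (fibreConst β lam / (μ : ℝ) ^ 3) ^ 2 = ((β * rad lam) ^ 2 * 7 ^ 2 + rad lam ^ 2 * 7 ^ 2 +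
      rad lam ^ 2 * (2 * (Real.exp ell * 16) ^ 2)) / (μ : ℝ) ^ 6 := by
    rw [div_pow, fibreConst, Real.sq_sqrt (by positivity), ← pow_mul]
  have hre : (secLift s + t • v).1.1.re = s := by simp [secLift, h1]
  rw [h1, norm_mul, norm_mul, Complex.norm_exp, Complex.norm_exp, Complex.neg_re, hre, hK]
  have e1 : Real.exp s ≤ Real.exp ell := Real.exp_le_exp.mpr hs.2.le
  have e2 : Real.exp (-s) ≤ Real.exp ell :=
    Real.exp_le_exp.mpr (by linarith [hs.1, half_lt_ell])
  rw [zero_pow two_ne_zero, mul_zero, zero_add]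
  refine (vertical_le _ _ _ _ _ hμ).trans ?_
  have e3 : v.1.1.im ^ 2 ≤ 7 ^ 2 := sq_le_sq' (abs_le.mp h2).1 (abs_le.mp h2).2
  have e4 : v.2 ^ 2 ≤ 7 ^ 2 := sq_le_sq' (abs_le.mp h5).1 (abs_le.mp h5).2
  have e5 : (Real.exp s * ‖v.1.2.1‖) ^ 2 + (Real.exp (-s) * ‖v.1.2.2‖) ^ 2 ≤
      2 * (Real.exp ell * 16) ^ 2 := by
    rw [two_mul]
    gcongr
  gcongr

/-- Two points are joined by going along a fibre to the section, along the section, and back along a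
fibre. -/
theorem riemEDist_metricN_ne_top (μ : Set.Ici (1 : ℝ)) (x y : N) :
    riemEDist (metricN hα hβ hlam μ) x y ≠ ⊤ := by
  have h (x : N) : riemEDist (metricN hα hβ hlam μ) (sec (proj x)) x ≠ ⊤ :=
    ((riemEDist_sec_proj_le hα hβ hlam μ x).trans_lt ENNReal.ofReal_lt_top).ne
  refine ne_top_of_le_ne_top ?_ (riemEDist_triangle _ x (sec (proj x)) y)
  refine ENNReal.add_ne_top.mpr ⟨by rw [riemEDist_comm]; exact h x, ?_⟩
  refine ne_top_of_le_ne_top ?_ (riemEDist_triangle _ _ (sec (proj y)) y)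
  exact ENNReal.add_ne_top.mpr ⟨ne_top_of_le_ne_top (riemEDist_metricB_ne_top hα hlam _ _)
    (riemEDist_sec_le hα hβ hlam μ _ _), h y⟩

end Comparison

/-! ### Gromov–Hausdorff limits from dense isometric embeddings. -/

section GromovHausdorff

/-- `X` itself serves as the common ambient space: there the Hausdorff distance between `X` and the
δ-dense copy of `Y` is at most δ. -/
theorem dist_toGHSpace_le {X Y : Type*} [MetricSpace X] [CompactSpace X] [Nonempty X]
    [MetricSpace Y] [CompactSpace Y] [Nonempty Y] {σ : Y → X} (hσ : Isometry σ) {δ : ℝ}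
    (hδ : ∀ x, ∃ y, dist x (σ y) ≤ δ) :
    dist (GromovHausdorff.toGHSpace X) (GromovHausdorff.toGHSpace Y) ≤ δ := by
  have hδ0 : 0 ≤ δ := by
    obtain ⟨y, hy⟩ := hδ (Classical.arbitrary X)
    exact dist_nonneg.trans hy
  refine (GromovHausdorff.ghDist_le_hausdorffDist isometry_id hσ).trans ?_
  refine Metric.hausdorffDist_le_of_mem_dist hδ0 ?_ ?_
  · rintro x -
    obtain ⟨y, hy⟩ := hδ x
    exact ⟨_, ⟨y, rfl⟩, hy⟩
  · rintro x -
    exact ⟨x, by simp, by simpa using hδ0⟩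

theorem ghConverges_of_isometry {ι X Y : Type*} [Nonempty X] [Nonempty Y] {l : Filter ι}
    {d : ι → MetricSpace X} {d' : MetricSpace Y}
    (hX : ∀ i, @CompactSpace X (d i).toUniformSpace.toTopologicalSpace)
    (hY : @CompactSpace Y d'.toUniformSpace.toTopologicalSpace) {σ : Y → X}
    (hσ : ∀ i y y', (d i).dist (σ y) (σ y') = d'.dist y y') {δ : ι → ℝ}
    (hδ : ∀ i x, ∃ y, (d i).dist x (σ y) ≤ δ i) (hl : Tendsto δ l (𝓝 0)) :
    GHConverges l d d' := by
  refine ⟨hX, hY, tendsto_iff_dist_tendsto_zero.mpr ?_⟩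
  refine squeeze_zero (fun _ => dist_nonneg) (fun i => ?_) hl
  let _ := d i
  have := hX i
  exact dist_toGHSpace_le (Isometry.of_dist_eq (hσ i)) (hδ i)

end GromovHausdorff

/-- Closedness of the subgroup provides the separation of the quotient `X`, on which the existence
of the distances on `N` depends. -/
instance : IsClosed (Delta : Set H) := by
  have : T2Space H := H.coordsHomeo.symm.t2Space
  have : DiscreteTopology Delta := isDiscrete_Delta.to_subtype
  exact Subgroup.isClosed_of_discrete

instance : CompactSpace N := compactSpace_N

instance : Fact (0 < ell) := ⟨by linarith [half_lt_ell]⟩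

theorem edist_eq_ofReal_dist {X : Type*} (d : MetricSpace X) (x y : X) :
    d.edist x y = ENNReal.ofReal (d.dist x y) :=
  edist_dist x y

/-- A comparison of extended distances is a comparison of distances. -/
theorem dist_le_of_edist_le {X Y : Type*} {d : MetricSpace X} {d' : MetricSpace Y} {x y : X}
    {x' y' : Y} (h : d.edist x y ≤ d'.edist x' y') : d.dist x y ≤ d'.dist x' y' := by
  rw [edist_eq_ofReal_dist, edist_eq_ofReal_dist] at h
  exact (ENNReal.ofReal_le_ofReal_iff (dist_nonneg (x := x') (y := y'))).mp h

/-! ### Quantitative comparison of the distances on total space and base. -/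

section Convergence

variable {α β : ℝ} (hα : α ≠ 0) (hβ : β ≠ 0) {lam : ℂ} (hlam : lam ≠ 0)
  {dB : MetricSpace (AddCircle ell)} (hB : IsRiemannianDistance (metricB hα hlam) dB)
  {μ : Set.Ici (1 : ℝ)} {dN : MetricSpace N}
  (hN : IsRiemannianDistance (metricN hα hβ hlam μ) dN)
include hB hN

theorem dist_proj_le (x y : N) : dB.dist (proj x) (proj y) ≤ dN.dist x y :=
  dist_le_of_edist_le (by
    rw [hB.edist_eq, hN.edist_eq]; exact riemEDist_proj_le hα hβ hlam μ x y)

/-- `sec` and `proj` are both 1-Lipschitz and `proj` inverts `sec` on its image, so no distance can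
shrink. -/
theorem dist_sec (s t : AddCircle ell) : dN.dist (sec s) (sec t) = dB.dist s t := by
  refine le_antisymm (dist_le_of_edist_le (by
    rw [hB.edist_eq, hN.edist_eq]; exact riemEDist_sec_le hα hβ hlam μ s t)) ?_
  simpa only [proj_sec] using dist_proj_le hα hβ hlam hB hN (sec s) (sec t)

omit hB in
theorem dist_sec_proj_le (x : N) : dN.dist x (sec (proj x)) ≤ fibreConst β lam / (μ : ℝ) ^ 3 := by
  have hμ : (1 : ℝ) ≤ μ := μ.2
  have h : dN.edist (sec (proj x)) x ≤ ENNReal.ofReal (fibreConst β lam / (μ : ℝ) ^ 3) := by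
    rw [hN.edist_eq]; exact riemEDist_sec_proj_le hα hβ hlam μ x
  rw [edist_eq_ofReal_dist, ENNReal.ofReal_le_ofReal_iff
    (div_nonneg (fibreConst_nonneg β lam) (by positivity))] at h
  exact (dist_comm x (sec (proj x))).trans_le h

theorem dist_le_dist_proj_add (x y : N) :
    dN.dist x y ≤ dB.dist (proj x) (proj y) + 2 * (fibreConst β lam / (μ : ℝ) ^ 3) := by
  have h1 := dist_sec_proj_le hα hβ hlam hN x
  have h2 := dist_sec_proj_le hα hβ hlam hN y
  have h3 := dist_sec hα hβ hlam hB hN (proj x) (proj y)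
  have h4 : dN.dist x y ≤ dN.dist x (sec (proj x)) + dN.dist (sec (proj x)) (sec (proj y)) +
    dN.dist (sec (proj y)) y := dist_triangle4 ..
  have h5 : dN.dist (sec (proj y)) y = dN.dist y (sec (proj y)) := dist_comm ..
  linarith

end Convergence

theorem tendsto_const_div_pow_Ici (c : ℝ) {n : ℕ} (hn : n ≠ 0) :
    Tendsto (fun μ : Set.Ici (1 : ℝ) => c / (μ : ℝ) ^ n) atTop (𝓝 0) :=
  ((tendsto_pow_atTop hn).comp (tendsto_Ici_atTop.mp tendsto_id)).const_div_atTop c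

end NakamuraG2

end

theorem theorem1p2 (α β : ℝ) (hα : α ≠ 0) (hβ : β ≠ 0) (lam : ℂ) (hlam : lam ≠ 0) :
    ∃ (g : Set.Ici (1 : ℝ) → Bundle.ContMDiffRiemannianMetric NakamuraG2.IN ∞
          ((ℂ × ℂ × ℂ) × ℝ) (fun x : NakamuraG2.N => TangentSpace NakamuraG2.IN x))
      (gB : Bundle.ContMDiffRiemannianMetric 𝓘(ℝ, ℝ) ∞ ℝ
          (fun t : AddCircle NakamuraG2.ell => TangentSpace 𝓘(ℝ, ℝ) t))
      (dN : Set.Ici (1 : ℝ) → MetricSpace NakamuraG2.N)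
      (dB : MetricSpace (AddCircle NakamuraG2.ell)),
      -- `g μ` is the metric of the `G₂` 3-form `μ⁻¹² φ(α, β, λ; μ)` on `N`
      (∀ (μ : Set.Ici (1 : ℝ)) (x : NakamuraG2.N),
        NakamuraG2.IsG2Metric (((μ : ℝ) ^ 12)⁻¹ • NakamuraG2.phi α β lam μ x)
          (fun u v => (g μ).inner x u v)) ∧
      -- `gB = α² (λ λ̄)^(-2/3) g_E` on `ℝ / ℓℤ`
      (∀ (t : AddCircle NakamuraG2.ell) (a b : TangentSpace 𝓘(ℝ, ℝ) t),
        gB.inner t a b = α ^ 2 * (Complex.normSq lam) ^ (-(2 / 3) : ℝ) *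
          (NakamuraG2.dt NakamuraG2.ell t a * NakamuraG2.dt NakamuraG2.ell t b)) ∧
      -- the distances are the Riemannian distances
      (∀ μ, NakamuraG2.IsRiemannianDistance (g μ) (dN μ)) ∧
      NakamuraG2.IsRiemannianDistance gB dB ∧
      -- Gromov–Hausdorff convergence
      NakamuraG2.GHConverges atTop dN dB ∧
      -- the limit is an adiabatic limit of `p`: `p` is a smooth surjective submersion, `g μ`
      -- converges uniformly to `p^* gB`, and `p` realises the convergence of the distances
      ContMDiff NakamuraG2.IN 𝓘(ℝ, ℝ) ∞ NakamuraG2.proj ∧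
      Function.Surjective NakamuraG2.proj ∧
      (∀ x : NakamuraG2.N,
        Function.Surjective (mfderiv NakamuraG2.IN 𝓘(ℝ, ℝ) NakamuraG2.proj x)) ∧
      (∀ ε : ℝ, 0 < ε → ∀ᶠ μ in atTop, ∀ (x : NakamuraG2.N) (u : TangentSpace NakamuraG2.IN x),
        |(g μ).inner x u u -
            gB.inner (NakamuraG2.proj x) (mfderiv NakamuraG2.IN 𝓘(ℝ, ℝ) NakamuraG2.proj x u)
              (mfderiv NakamuraG2.IN 𝓘(ℝ, ℝ) NakamuraG2.proj x u)|
          ≤ ε * (g ⟨1, Set.mem_Ici.mpr le_rfl⟩).inner x u u) ∧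
      TendstoUniformly (fun μ (q : NakamuraG2.N × NakamuraG2.N) => (dN μ).dist q.1 q.2)
        (fun q => dB.dist (NakamuraG2.proj q.1) (NakamuraG2.proj q.2)) atTop := by
  obtain ⟨dB, hB⟩ := NakamuraG2.exists_isRiemannianDistance _
    (NakamuraG2.riemEDist_metricB_ne_top hα hlam)
  choose dN hN using fun μ => NakamuraG2.exists_isRiemannianDistance _
    (NakamuraG2.riemEDist_metricN_ne_top hα hβ hlam μ)
  refine ⟨NakamuraG2.metricN hα hβ hlam, NakamuraG2.metricB hα hlam, dN, dB,
    NakamuraG2.isG2Metric_metricN hα hβ hlam, fun t a b => ?_, hN, hB, ?_,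
    NakamuraG2.contMDiff_proj, NakamuraG2.surjective_proj, NakamuraG2.surjective_mfderiv_proj,
    fun ε hε => ?_, ?_⟩
  · rw [NakamuraG2.metricB_inner, NakamuraG2.sq_div_rad]
  -- The section is isometric for every μ, and every point lies within `fibreConst` / μ³ of it.
  · refine NakamuraG2.ghConverges_of_isometry (fun μ => ?_) ?_
      (fun μ => NakamuraG2.dist_sec hα hβ hlam hB (hN μ))
      (fun μ x => ⟨_, NakamuraG2.dist_sec_proj_le hα hβ hlam (hN μ) x⟩)
      (NakamuraG2.tendsto_const_div_pow_Ici _ three_ne_zero)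
    · rw [(hN μ).topology_eq]; infer_instance
    · rw [hB.topology_eq]; infer_instance
  -- The vertical part is at most μ⁻⁶ times the metric at μ = 1, so μ⁻⁶ ≤ ε suffices uniformly in
  -- point and vector.
  · have h := (NakamuraG2.tendsto_const_div_pow_Ici 1 (n := 6) (by norm_num)).eventually_le_const hε
    filter_upwards [h] with μ hμ x u
    rw [abs_of_nonneg (NakamuraG2.metricN_sub_metricB_nonneg hα hβ hlam μ x u)]
    refine (NakamuraG2.metricN_sub_metricB_le hα hβ hlam μ x u).trans ?_
    refine mul_le_mul_of_nonneg_right (by rwa [← one_div]) ?_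
    rw [NakamuraG2.metricN_inner_self]
    positivity
  · rw [Metric.tendstoUniformly_iff]
    intro ε hε
    -- The distance upstairs exceeds the distance of the projections by an amount between 0 and 2
    -- `fibreConst` / μ³, one fibre segment for each endpoint.
    have h := (NakamuraG2.tendsto_const_div_pow_Ici (2 * NakamuraG2.fibreConst β lam)
      three_ne_zero).eventually_lt_const hε
    filter_upwards [h] with μ hμ q
    have h1 := NakamuraG2.dist_proj_le hα hβ hlam hB (hN μ) q.1 q.2
    have h2 := NakamuraG2.dist_le_dist_proj_add hα hβ hlam hB (hN μ) q.1 q.2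
    rw [mul_div_assoc] at hμ
    rw [Real.dist_eq, abs_sub_comm, abs_of_nonneg (sub_nonneg.mpr h1)]
    linarith
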